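/- All graphs are finite and simple. A proper orientation of a graph $G$ is an orientation of its edges such that any two adjacent vertices have different outdegrees. The proper chromatic number $\vec{\chi}(G)$ is the minimum, over all proper orientations of $G$, of the largest outdegree. Let $\mathrm{MAD}(G)=\max_{H}\frac{2|E(H)|}{|V(H)|}$, the maximum being over all subgraphs $H\subseteq G$ with at least one vertex (and $\mathrm{MAD}(G)=0$ if $G$ has no vertices). For an integer $r\ge 1$ let $t(r)$ be the smallest non-negative integer $t$ with $t^{t+1}\ge r-1$. (1) Let $r\ge 1$ and $k\ge 0$ be integers and let $G$ be an $r$-partite graph (that is, $V(G)$ can be partitioned into $r$ independent sets, possibly empty) with $\mathrm{MAD}(G)\le 2k$. Then $G$ has a proper orientation, and $$\vec{\chi}(G)\le k+3r\,(t(r)+1).$$ (2) There is a function $\varepsilon:\mathbb{N}\to\mathbb{R}$ with $\varepsilon(r)\to 0$ as $r\to\infty$ such that for every integer $r\ge 3$ $$3r\,(t(r)+1)\le \frac{3(1+\varepsilon(r))\,r\log r}{\log\log r};$$ so the bound in (1) is at most $k+\frac{3(1+o(1))\,r\log r}{\log\log r}$, where the $o(1)$ term depends only on $r$. (3) There is an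 absolute constant $C$ such that every graph $G$ with chromatic number $r=\chi(G)\ge 3$ satisfies $$\vec{\chi}(G)\le \tfrac12\mathrm{MAD}(G)+C\,\frac{r\log r}{\log\log r}.$$ -/

import Mathlib

open Filter Topology

namespace SimpleGraph

/-- An orientation of `G`: each edge `uv` receives exactly one of the directions `u → v`, `v → u`,
and non-adjacent pairs receive none. -/
structure Orientation {V : Type*} (G : SimpleGraph V) where
  /-- `dir u v` means that `uv` is an edge, oriented from `u` to `v`. -/
  dir : V → V → Prop
  adj_iff : ∀ u v, G.Adj u v ↔ dir u v ∨ dir v u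
  asymm : ∀ u v, dir u v → ¬ dir v u

/-- The outdegree of `v` (the graphs considered are finite). -/
noncomputable def Orientation.outdegree {V : Type*} {G : SimpleGraph V} (D : G.Orientation)
    (v : V) : ℕ :=
  {w | D.dir v w}.ncard

/-- An orientation is proper if adjacent vertices have different outdegrees. -/
def Orientation.IsProper {V : Type*} {G : SimpleGraph V} (D : G.Orientation) : Prop :=
  ∀ u v, G.Adj u v → D.outdegree u ≠ D.outdegree v

/-- The proper chromatic number: the minimum over all proper orientations of the largest outdegree.
As for `SimpleGraph.chromaticNumber`, the value lies in `ℕ∞`, and it would be `⊤` if there were no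
proper orientation; a finite upper bound therefore includes the existence of one. -/
noncomputable def properChromaticNumber {V : Type*} (G : SimpleGraph V) : ℕ∞ :=
  ⨅ (D : G.Orientation) (_ : D.IsProper), ⨆ v : V, (D.outdegree v : ℕ∞)

/-- The maximum average degree: the largest value of `2|E(H)| / |V(H)|` over the subgraphs `H` of
`G` with at least one vertex. For a finite nonempty graph it is a maximum over a finite nonempty
set; for the graph without vertices the value is `0`. -/
noncomputable def mad {V : Type*} (G : SimpleGraph V) : ℝ :=
  sSup {x : ℝ | ∃ H : G.Subgraph, H.verts.Nonempty ∧
    x = 2 * (H.edgeSet.ncard : ℝ) / (H.verts.ncard : ℝ)}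

end SimpleGraph

namespace SimpleGraph

/-! ### Partial orientations and the basic pulling move. -/

section Stages

open Finset Classical

variable {V : Type*} [Fintype V] {G : SimpleGraph V}

/-! Hakimi's theorem gives an orientation with all outdegrees at most `k`. Outdegrees are then fixed
from the top value `K = k + 3r(t+1)` downwards: at each value `c + 1` an independent set `B` of
unfixed vertices, each able to reach `c + 1`, pulls its edges inside the unfixed set `R` and gives
back the surplus, so that each vertex of `B` gets outdegree exactly `c + 1`. Fixed vertices at
different values cannot conflict, and those at the same value are non-adjacent. Once every unfixed
potential is at most the current value `c`, a greedy argument (`IsStage.exists_proper`) finishes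
without conflicts.

It remains to bring the excess of the potentials over the current value to `0`. Taking colour
classes for `B` during `r` levels gives excess at most `r - 1` (`IsStage.exists_of_coloring`).
Giving back edges raises the potentials of the receivers, so the returned edges are spread evenly
using Hall's theorem (`Finset.exists_equitable_selection`). A round of `r` levels then divides the
excess by about `t` (`IsStage.exists_shrink`); since `r - 1 ≤ t ^ (t + 1)`, `t + 1` rounds reduce it
to `1`. The last unit is removed in `r` further levels with independent sets of maximum weight
(`IsStage.exists_clear`). These `(t + 3) r` levels end at `k + 2tr`; staying well above `k`
guarantees enough incoming edges to choose from. -/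

theorem Orientation.outdegree_eq_card (D : G.Orientation) (v : V) :
    D.outdegree v = #{w | D.dir v w} := by
  unfold Orientation.outdegree
  rw [Set.ncard_eq_toFinset_card']
  congr 1
  ext w
  simp

omit [Fintype V] in
theorem Orientation.adj_of_dir (D : G.Orientation) {u v : V} (h : D.dir u v) : G.Adj u v :=
  (D.adj_iff u v).2 (Or.inl h)

/-- The largest outdegree that `u` can reach by reorienting edges inside the set `R`. -/
noncomputable def Orientation.potential (D : G.Orientation) (R : Finset V) (u : V) : ℕ :=
  #{v | v ∉ R ∧ D.dir u v} + #{v ∈ R | G.Adj u v}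

/-- When the outdegree is at most `k`, this forces at least `potential - k` incoming edges inside
`R`: the supply from which edges are given back. -/
theorem Orientation.potential_eq (D : G.Orientation) (R : Finset V) (u : V) :
    D.potential R u = D.outdegree u + #{w ∈ R | D.dir w u} := by
  have h1 : D.outdegree u = #{v | v ∉ R ∧ D.dir u v} + #{v ∈ R | D.dir u v} := by
    rw [D.outdegree_eq_card, ← card_union_of_disjoint]
    · congr 1
      ext v
      simp
      tauto
    · rw [Finset.disjoint_left]
      simp
      tauto
  have h2 : #{v ∈ R | G.Adj u v} = #{v ∈ R | D.dir u v} + #{w ∈ R | D.dir w u} := by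
    rw [← card_union_of_disjoint]
    · congr 1
      ext v
      simp only [mem_filter, mem_union, D.adj_iff u v]
      tauto
    · rw [Finset.disjoint_left]
      simp only [mem_filter, not_and]
      exact fun v h _ => D.asymm _ _ h.2
  rw [potential, h1, h2]
  ring

/-- `D` orients the edges so that the vertices outside `R` have pairwise compatible outdegrees
in `(c, K]` and the vertices in `R` have outdegree at most `k`. -/
structure IsStage (D : G.Orientation) (R : Finset V) (k K c : ℕ) : Prop where
  ne : ∀ u v, u ∉ R → v ∉ R → G.Adj u v → D.outdegree u ≠ D.outdegree v
  lt : ∀ v, v ∉ R → c < D.outdegree v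
  le : ∀ v, v ∉ R → D.outdegree v ≤ K
  out_le : ∀ u ∈ R, D.outdegree u ≤ k

/-- Each vertex `v` of an independent set `B` pulls all its edges inside `R`
except those to `Γ v`. -/
theorem Orientation.exists_pull (D : G.Orientation) {R B : Finset V} (hBR : B ⊆ R)
    (hB : ∀ u ∈ B, ∀ v ∈ B, ¬ G.Adj u v) (Γ : V → Finset V)
    (hΓ : ∀ v ∈ B, ∀ w ∈ Γ v, w ∈ R ∧ D.dir w v) :
    ∃ D' : G.Orientation,
      (∀ v ∈ B, D'.outdegree v + #(Γ v) = D.potential R v) ∧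
      (∀ v, v ∉ R → D'.outdegree v = D.outdegree v) ∧
      (∀ w ∈ R \ B, D'.outdegree w ≤ D.outdegree w) ∧
      (∀ w ∈ R \ B, D'.potential (R \ B) w + #{v ∈ B | G.Adj v w} =
        D.potential R w + #{v ∈ B | w ∈ Γ v}) ∧
      (∀ a ∈ R \ B, ∀ b ∈ R \ B, (D'.dir a b ↔ D.dir a b)) := by
  let dir' : V → V → Prop := fun a b =>
    (D.dir a b ∧ ¬ (b ∈ B ∧ a ∈ R ∧ a ∉ Γ b)) ∨ (a ∈ B ∧ b ∈ R ∧ D.dir b a ∧ b ∉ Γ a)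
  have hadj : ∀ {a b}, D.dir a b → G.Adj a b := fun h => D.adj_of_dir h
  let D' : G.Orientation :=
    { dir := dir'
      adj_iff := by
        intro u v
        rw [D.adj_iff u v]
        simp only [dir']
        tauto
      asymm := by
        intro u v h1 h2
        simp only [dir'] at h1 h2
        have := D.asymm u v
        rcases h1 with h1 | h1 <;> rcases h2 with h2 | h2
        · tauto
        · tauto
        · tauto
        · exact hB u h1.1 v h2.1 (hadj h2.2.2.1) }
  have hD' : ∀ a b, D'.dir a b ↔ dir' a b := fun _ _ => Iff.rfl
  refine ⟨D', ?_, ?_, ?_, ?_, ?_⟩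
  · intro v hv
    have h1 : D'.outdegree v = #{w | D.dir v w} + #({w ∈ R | D.dir w v} \ Γ v) := by
      rw [D'.outdegree_eq_card, ← card_union_of_disjoint]
      · congr 1
        ext w
        simp only [hD', dir', mem_filter, mem_univ, true_and, mem_union, Finset.mem_sdiff]
        have : D.dir v w → w ∉ B := fun h hw => hB v hv w hw (hadj h)
        tauto
      · rw [Finset.disjoint_left]
        simp only [mem_filter, mem_univ, true_and, Finset.mem_sdiff]
        intro w h1 h2
        exact D.asymm _ _ h1 h2.1.2
    have h2 : Γ v ⊆ ({w ∈ R | D.dir w v} : Finset V) := by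
      intro w hw
      simpa using hΓ v hv w hw
    rw [D.potential_eq, h1, D.outdegree_eq_card, card_sdiff_of_subset h2]
    have := card_le_card h2
    omega
  · intro v hv
    rw [D'.outdegree_eq_card, D.outdegree_eq_card]
    congr 1
    ext w
    simp only [hD', dir', mem_filter, mem_univ, true_and]
    have := @hBR v
    tauto
  · intro w hw
    rw [D'.outdegree_eq_card, D.outdegree_eq_card]
    apply card_le_card
    intro x
    simp only [Finset.mem_sdiff] at hw
    simp only [hD', dir', mem_filter, mem_univ, true_and]
    tauto
  · intro w hw
    rw [Finset.mem_sdiff] at hw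
    have h1 : #{v | v ∉ R \ B ∧ D'.dir w v} = #{v | v ∉ R ∧ D.dir w v} + #{v ∈ B | w ∈ Γ v} := by
      rw [← card_union_of_disjoint]
      · congr 1
        ext v
        simp only [hD', dir', mem_filter, mem_univ, true_and, mem_union, Finset.mem_sdiff]
        have := hΓ v
        have := @hBR v
        have := D.asymm v w
        by_cases hv : v ∈ B
        · have h3 := hΓ v hv w
          tauto
        · tauto
      · rw [Finset.disjoint_left]
        simp only [mem_filter, mem_univ, true_and, not_and]
        intro v h1 h2
        exact absurd (hBR h2) h1.1
    have h2 : #{v ∈ R | G.Adj w v} = #{v ∈ R \ B | G.Adj w v} + #{v ∈ B | G.Adj v w} := by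
      rw [← card_union_of_disjoint]
      · congr 1
        ext v
        simp only [mem_filter, mem_union, Finset.mem_sdiff, G.adj_comm v w]
        have := @hBR v
        tauto
      · rw [Finset.disjoint_left]
        simp only [mem_filter, Finset.mem_sdiff]
        tauto
    have h3 : D'.potential (R \ B) w =
        #{v | v ∉ R \ B ∧ D'.dir w v} + #{v ∈ R \ B | G.Adj w v} := by
      unfold potential
      congr!
    rw [h3, potential, h1, h2]
    ring
  · intro a ha b hb
    simp only [Finset.mem_sdiff] at ha hb
    simp only [hD', dir']
    tauto

/-- All of `B` lands on the value `c + 1`, strictly below every earlier fixed outdegree;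
independence of `B` excludes conflicts within it. -/
theorem IsStage.pull {D : G.Orientation} {R B : Finset V} {k K c : ℕ}
    (h : IsStage D R k K (c + 1)) (hc : c + 1 ≤ K) (hBR : B ⊆ R)
    (hB : ∀ u ∈ B, ∀ v ∈ B, ¬ G.Adj u v) (Γ : V → Finset V)
    (hΓ : ∀ v ∈ B, ∀ w ∈ Γ v, w ∈ R ∧ D.dir w v)
    (hcard : ∀ v ∈ B, c + 1 + #(Γ v) = D.potential R v) :
    ∃ D' : G.Orientation, IsStage D' (R \ B) k K c ∧
      (∀ w ∈ R \ B, D'.potential (R \ B) w + #{v ∈ B | G.Adj v w} =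
        D.potential R w + #{v ∈ B | w ∈ Γ v}) ∧
      (∀ a ∈ R \ B, ∀ b ∈ R \ B, (D'.dir a b ↔ D.dir a b)) := by
  obtain ⟨D', h1, h2, h3, h4, h5⟩ := D.exists_pull hBR hB Γ hΓ
  have hval : ∀ v ∈ B, D'.outdegree v = c + 1 := fun v hv => by
    have := h1 v hv
    have := hcard v hv
    omega
  have hmem : ∀ v, v ∉ R \ B → v ∈ B ∨ v ∉ R := by
    intro v hv
    simp only [Finset.mem_sdiff] at hv
    tauto
  refine ⟨D', ⟨?_, ?_, ?_, ?_⟩, h4, h5⟩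
  · intro u v hu hv huv
    rcases hmem u hu with hu | hu <;> rcases hmem v hv with hv | hv
    · exact absurd huv (hB u hu v hv)
    · rw [hval u hu, h2 v hv]
      have := h.lt v hv
      omega
    · rw [hval v hv, h2 u hu]
      have := h.lt u hu
      omega
    · rw [h2 u hu, h2 v hv]
      exact h.ne u v hu hv huv
  · intro v hv
    rcases hmem v hv with hv | hv
    · rw [hval v hv]
      omega
    · rw [h2 v hv]
      have := h.lt v hv
      omega
  · intro v hv
    rcases hmem v hv with hv | hv
    · rw [hval v hv]
      omega
    · rw [h2 v hv]
      exact h.le v hv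
  · intro u hu
    exact (h3 u hu).trans (h.out_le u (Finset.mem_sdiff.1 hu).1)

/-- Greedy completion: a vertex of maximum potential pulls all its edges in `R`. Each unfixed
neighbour loses one unit of potential, so it falls strictly below the new outdegree and `hlt`
persists. -/
theorem Orientation.exists_proper_of_potential_lt (K : ℕ) (R : Finset V) (D : G.Orientation)
    (hne : ∀ u v, u ∉ R → v ∉ R → G.Adj u v → D.outdegree u ≠ D.outdegree v)
    (hle : ∀ v, v ∉ R → D.outdegree v ≤ K)
    (hpot : ∀ w ∈ R, D.potential R w ≤ K)
    (hlt : ∀ f, f ∉ R → ∀ w ∈ R, G.Adj f w → D.potential R w < D.outdegree f) :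
    ∃ D' : G.Orientation, D'.IsProper ∧ ∀ v, D'.outdegree v ≤ K := by
  induction hn : #R using Nat.strong_induction_on generalizing R D with
  | _ n ih =>
    rcases R.eq_empty_or_nonempty with rfl | hR
    · exact ⟨D, fun u v h => hne u v (by simp) (by simp) h, fun v => hle v (by simp)⟩
    · obtain ⟨u, huR, hu⟩ := exists_max_image R (D.potential R) hR
      have hBR : ({u} : Finset V) ⊆ R := by simpa using huR
      obtain ⟨D', h1, h2, h3, h4, h5⟩ := D.exists_pull hBR (by simp) (fun _ => ∅) (by simp)
      have hval : D'.outdegree u = D.potential R u := by simpa using h1 u (by simp)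
      have hpot' : ∀ w ∈ R \ {u}, D'.potential (R \ {u}) w ≤ D.potential R w := by
        intro w hw
        have := h4 w hw
        simp only [notMem_empty, filter_false, card_empty] at this
        omega
      have hmem : ∀ v, v ∉ R \ {u} → v = u ∨ v ∉ R := by
        intro v hv
        simp only [Finset.mem_sdiff, mem_singleton] at hv
        tauto
      refine ih #(R \ {u}) ?_ (R \ {u}) D' ?_ ?_ ?_ ?_ rfl
      · rw [← hn]
        exact card_lt_card (sdiff_ssubset hBR (by simp))
      · intro a b ha hb hab
        rcases hmem a ha with ha' | ha' <;> rcases hmem b hb with hb' | hb'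
        · rw [ha', hb'] at hab
          exact absurd hab (G.loopless.irrefl _)
        · rw [ha', hval, h2 b hb']
          exact (hlt b hb' u huR (ha' ▸ hab.symm)).ne
        · rw [hb', hval, h2 a ha']
          exact (hlt a ha' u huR (hb' ▸ hab)).ne'
        · rw [h2 a ha', h2 b hb']
          exact hne a b ha' hb' hab
      · intro v hv
        rcases hmem v hv with rfl | hv
        · rw [hval]
          exact hpot v huR
        · rw [h2 v hv]
          exact hle v hv
      · intro w hw
        exact (hpot' w hw).trans (hpot w (Finset.mem_sdiff.1 hw).1)
      · intro f hf w hw hfw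
        have hwR := (Finset.mem_sdiff.1 hw).1
        rcases hmem f hf with rfl | hf
        · rw [hval]
          have := h4 w hw
          simp only [notMem_empty, filter_false, card_empty] at this
          have h6 : #{v ∈ ({f} : Finset V) | G.Adj v w} = 1 := by
            rw [filter_singleton, if_pos hfw, card_singleton]
          have := hu w hwR
          omega
        · rw [h2 f hf]
          exact (hpot' w hw).trans_lt (hlt f hf w hwR hfw)

theorem IsStage.exists_proper {D : G.Orientation} {R : Finset V} {k K c : ℕ}
    (h : IsStage D R k K c) (hc : c ≤ K) (hpot : ∀ w ∈ R, D.potential R w ≤ c) :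
    ∃ D' : G.Orientation, D'.IsProper ∧ ∀ v, D'.outdegree v ≤ K :=
  D.exists_proper_of_potential_lt K R h.ne h.le (fun w hw => (hpot w hw).trans hc)
    fun f hf w hw _ => (hpot w hw).trans_lt (h.lt f hf)

/-- At level `K - j` all vertices of colour `j` that can reach the level are fixed. Potentials never
increase, because returned edges go only to neighbours of `B`; so a vertex left over by its own
colour's level stays below `K`. -/
theorem IsStage.exists_of_coloring {D : G.Orientation} {k K r : ℕ}
    (hD : ∀ v, D.outdegree v ≤ k) (col : V → ℕ) (hcol : ∀ u v, G.Adj u v → col u ≠ col v)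
    (hr : ∀ v, col v < r) (hK : k + r ≤ K) :
    ∃ (D' : G.Orientation) (R : Finset V), IsStage D' R k K (K - r) ∧
      ∀ w ∈ R, D'.potential R w ≤ K - 1 := by
  suffices H : ∀ j ≤ r, ∃ (D' : G.Orientation) (R : Finset V), IsStage D' R k K (K - j) ∧
      ∀ w ∈ R, col w < j → D'.potential R w ≤ K - 1 by
    obtain ⟨D', R, h1, h2⟩ := H r le_rfl
    exact ⟨D', R, h1, fun w hw => h2 w hw (hr w)⟩
  intro j
  induction j with
  | zero =>
    intro _
    exact ⟨D, univ, ⟨by simp, by simp, by simp, fun u _ => hD u⟩, by simp⟩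
  | succ j ih =>
    intro hj
    obtain ⟨D', R, h1, h2⟩ := ih (by omega)
    obtain ⟨c, hc⟩ : ∃ c, K - j = c + 1 := ⟨K - j - 1, by omega⟩
    have hc' : K - (j + 1) = c := by omega
    rw [hc] at h1
    rw [hc']
    let B : Finset V := {u ∈ R | col u = j ∧ c + 1 ≤ D'.potential R u}
    have hΓ : ∀ v, ∃ Γ : Finset V, v ∈ B → (∀ w ∈ Γ, w ∈ R ∧ D'.dir w v) ∧
        c + 1 + #Γ = D'.potential R v := by
      intro v
      by_cases hv : v ∈ B
      · simp only [B, mem_filter] at hv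
        have h3 := D'.potential_eq R v
        have h4 := h1.out_le v hv.1
        obtain ⟨Γ, h5, h6⟩ := exists_subset_card_eq
          (s := {w ∈ R | D'.dir w v}) (n := D'.potential R v - (c + 1)) (by omega)
        refine ⟨Γ, fun _ => ⟨fun w hw => by simpa using h5 hw, by omega⟩⟩
      · exact ⟨∅, fun h => absurd h hv⟩
    choose Γ hΓ using hΓ
    obtain ⟨D'', h3, h4, -⟩ := h1.pull (by omega) (B := B) (filter_subset _ _)
      (fun u hu v hv huv => hcol u v huv (by
        simp only [B, mem_filter] at hu hv
        rw [hu.2.1, hv.2.1])) Γ (fun v hv => (hΓ v hv).1) (fun v hv => (hΓ v hv).2)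
    refine ⟨D'', R \ B, h3, fun w hw hwj => ?_⟩
    have h5 := h4 w hw
    have h6 : #{v ∈ B | w ∈ Γ v} ≤ #{v ∈ B | G.Adj v w} := by
      apply card_le_card
      intro v
      simp only [mem_filter]
      exact fun h => ⟨h.1, (D'.adj_of_dir ((hΓ v h.1).1 w h.2).2).symm⟩
    rw [Finset.mem_sdiff] at hw
    have h7 : D'.potential R w ≤ K - 1 := by
      rcases Nat.lt_succ_iff_lt_or_eq.1 hwj with h | h
      · exact h2 w hw.1 h
      · by_contra h8
        refine hw.2 ?_
        simp only [B, mem_filter]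
        exact ⟨hw.1, h, by omega⟩
    omega

end Stages

end SimpleGraph

/-! ### Equitable selection through Hall's theorem. -/

section Selection

open Finset

/-- From sets `M v` of size at least `s * g` one can select subsets of size `s` in such a way that
the selected multiplicity of each point is about `1 / g` of its multiplicity in the sets `M v`. -/
theorem Finset.exists_equitable_selection {ι α : Type*} [DecidableEq ι] [DecidableEq α]
    (I : Finset ι) (M : ι → Finset α) (s g : ℕ) (hg : 0 < g) (hM : ∀ v ∈ I, s * g ≤ #(M v)) :
    ∃ Γ : ι → Finset α, (∀ v ∈ I, Γ v ⊆ M v ∧ #(Γ v) = s) ∧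
      ∀ w, #{v ∈ I | w ∈ Γ v} ≤ (#{v ∈ I | w ∈ M v} + g - 1) / g := by
  have hf : ∀ v : I, Nonempty (Fin s × Fin g ↪ M v.1) := fun v =>
    Function.Embedding.nonempty_of_card_le (by simpa using hM v.1 v.2)
  let f : ∀ v : I, Fin s × Fin g ↪ M v.1 := fun v => (hf v).some
  -- `P (v, i)` is the `i`-th of `s` disjoint groups of `g` points in `M v`; one representative of
  -- each group will be selected.
  let P : I × Fin s → Finset α := fun x => univ.image fun j : Fin g => (f x.1 (x.2, j)).1
  have hP : ∀ x, P x ⊆ M x.1 := by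
    intro x w hw
    simp only [P, mem_image, mem_univ, true_and] at hw
    obtain ⟨j, rfl⟩ := hw
    exact (f x.1 (x.2, j)).2
  have hPcard : ∀ x, #(P x) = g := by
    intro x
    rw [card_image_of_injective, card_univ, Fintype.card_fin]
    intro i j hij
    have := (f x.1).injective (Subtype.ext hij)
    simpa using this
  have hPinj : ∀ v i j w, w ∈ P (v, i) → w ∈ P (v, j) → i = j := by
    intro v i j w hi hj
    simp only [P, mem_image, mem_univ, true_and] at hi hj
    obtain ⟨a, rfl⟩ := hi
    obtain ⟨b, hb⟩ := hj
    have := (f v).injective (Subtype.ext hb)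
    simp only [Prod.mk.injEq] at this
    exact this.1.symm
  let cap : α → ℕ := fun w => (#{v ∈ I | w ∈ M v} + g - 1) / g
  have hcap : ∀ w, #{v ∈ I | w ∈ M v} ≤ g * cap w := by
    intro w
    have h1 := Nat.div_add_mod (#{v ∈ I | w ∈ M v} + g - 1) g
    have h2 := Nat.mod_lt (#{v ∈ I | w ∈ M v} + g - 1) hg
    simp only [cap]
    omega
  -- Each point `w` offers `cap w` slots. Hall's condition follows by double counting: a group has
  -- `g` points, and `w` lies in at most `g * cap w` groups.
  let t : I × Fin s → Finset (Σ _ : α, ℕ) := fun x => (P x).sigma fun w => range (cap w)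
  have hhall : ∀ S : Finset (I × Fin s), #S ≤ #(S.biUnion t) := by
    intro S
    have h1 : S.biUnion t = (S.biUnion P).sigma fun w => range (cap w) := by
      ext ⟨w, j⟩
      simp only [t, mem_biUnion, mem_sigma]
      tauto
    rw [h1, card_sigma]
    simp only [card_range]
    refine Nat.le_of_mul_le_mul_left ?_ hg
    calc g * #S = ∑ x ∈ S, #((S.biUnion P).bipartiteAbove (fun x w => w ∈ P x) x) := by
          rw [mul_comm, ← smul_eq_mul, ← sum_const]
          refine sum_congr rfl fun x hx => ?_
          rw [← hPcard x]
          congr 1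
          ext w
          simp only [mem_bipartiteAbove, mem_biUnion]
          exact ⟨fun h => ⟨⟨x, hx, h⟩, h⟩, fun h => h.2⟩
      _ = ∑ w ∈ S.biUnion P, #(S.bipartiteBelow (fun x w => w ∈ P x) w) :=
          sum_card_bipartiteAbove_eq_sum_card_bipartiteBelow _
      _ ≤ ∑ w ∈ S.biUnion P, g * cap w := by
          refine sum_le_sum fun w _ => le_trans ?_ (hcap w)
          refine card_le_card_of_injOn (fun x => x.1.1) ?_ ?_
          · intro x hx
            simp only [coe_bipartiteBelow, Set.mem_ofPred_eq] at hx
            simp only [coe_filter, Set.mem_ofPred_eq]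
            exact ⟨x.1.2, hP x hx.2⟩
          · rintro ⟨v, i⟩ hx ⟨v', i'⟩ hx' h
            simp only [coe_bipartiteBelow, Set.mem_ofPred_eq] at hx hx'
            obtain rfl : v = v' := Subtype.ext h
            rw [hPinj v i i' w hx.2 hx'.2]
      _ = g * ∑ w ∈ S.biUnion P, cap w := (mul_sum _ _ _).symm
  obtain ⟨φ, hφ, hφt⟩ := (all_card_le_biUnion_card_iff_exists_injective t).1 hhall
  have hφP : ∀ x, (φ x).1 ∈ P x := fun x => (mem_sigma.1 (hφt x)).1
  have hφc : ∀ x, (φ x).2 < cap (φ x).1 := fun x => mem_range.1 (mem_sigma.1 (hφt x)).2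
  refine ⟨fun v => if h : v ∈ I then univ.image fun i : Fin s => (φ (⟨v, h⟩, i)).1 else ∅, ?_, ?_⟩
  · intro v hv
    simp only [dif_pos hv]
    constructor
    · intro w hw
      simp only [mem_image, mem_univ, true_and] at hw
      obtain ⟨i, rfl⟩ := hw
      exact hP _ (hφP (⟨v, hv⟩, i))
    · rw [card_image_of_injective, card_univ, Fintype.card_fin]
      intro i j hij
      refine hPinj ⟨v, hv⟩ i j _ (hφP (⟨v, hv⟩, i)) ?_
      have := hφP (⟨v, hv⟩, j)
      simp only at hij
      rwa [← hij] at this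
  · intro w
    have hex : ∀ v, ∃ j, v ∈ I → w ∈ (if h : v ∈ I then
        univ.image fun i : Fin s => (φ (⟨v, h⟩, i)).1 else ∅) →
        ∃ (h : v ∈ I) (i : Fin s), φ (⟨v, h⟩, i) = ⟨w, j⟩ := by
      intro v
      by_cases hv : v ∈ I
      · by_cases hw : w ∈ univ.image fun i : Fin s => (φ (⟨v, hv⟩, i)).1
        · have hw' := hw
          simp only [mem_image, mem_univ, true_and] at hw'
          obtain ⟨i, hi⟩ := hw'
          exact ⟨(φ (⟨v, hv⟩, i)).2, fun _ _ => ⟨hv, i, by rw [← hi]⟩⟩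
        · exact ⟨0, fun _ h => absurd (by simpa only [dif_pos hv] using h) hw⟩
      · exact ⟨0, fun h => absurd h hv⟩
    choose j hj using hex
    calc _ ≤ #(range (cap w)) := by
          refine card_le_card_of_injOn j ?_ ?_
          · intro v hv
            simp only [coe_filter, Set.mem_ofPred_eq] at hv
            obtain ⟨h, i, hi⟩ := hj v hv.1 hv.2
            have := hφc (⟨v, h⟩, i)
            rw [hi] at this
            simpa using this
          · intro v hv v' hv' hvv
            simp only [coe_filter, Set.mem_ofPred_eq] at hv hv'
            obtain ⟨h, i, hi⟩ := hj v hv.1 hv.2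
            obtain ⟨h', i', hi'⟩ := hj v' hv'.1 hv'.2
            rw [← hvv, ← hi] at hi'
            have := hφ hi'
            simp only [Prod.mk.injEq, Subtype.mk.injEq] at this
            exact this.1.symm
      _ = cap w := card_range _

end Selection

namespace SimpleGraph

/-! ### Shrinking the excess over `r` levels. -/

section Window

open Finset Classical

variable {V : Type*} [Fintype V] {G : SimpleGraph V}

omit [Fintype V] in
theorem exists_maximal_independent (G : SimpleGraph V) (A B₀ : Finset V) (h₀ : B₀ ⊆ A)
    (hB₀ : ∀ u ∈ B₀, ∀ v ∈ B₀, ¬ G.Adj u v) :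
    ∃ B, B₀ ⊆ B ∧ B ⊆ A ∧ (∀ u ∈ B, ∀ v ∈ B, ¬ G.Adj u v) ∧
      ∀ w ∈ A, w ∉ B → ∃ v ∈ B, G.Adj v w := by
  obtain ⟨B, hB, hmax⟩ := exists_max_image
    {B ∈ A.powerset | B₀ ⊆ B ∧ ∀ u ∈ B, ∀ v ∈ B, ¬ G.Adj u v} card
    ⟨B₀, by simpa [h₀] using hB₀⟩
  simp only [mem_filter, mem_powerset] at hB hmax
  refine ⟨B, hB.2.1, hB.1, hB.2.2, fun w hw hwB => ?_⟩
  by_contra! hcon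
  have := hmax (insert w B) ⟨insert_subset hw hB.1, hB.2.1.trans (subset_insert _ _), ?_⟩
  · rw [card_insert_of_notMem hwB] at this
    omega
  · intro u hu v hv
    rw [mem_insert] at hu hv
    rcases hu with rfl | hu <;> rcases hv with rfl | hv
    · exact G.loopless.irrefl _
    · exact fun h => hcon v hv h.symm
    · exact hcon u hu
    · exact hB.2.2 u hu v hv

omit [Fintype V] in
/-- Greedy assignment of levels `0, 1, …, n`: the levels below `n` are independent sets, the class
of colour `j` being preferred at level `j`, and level `n` collects the vertices that remain. -/
theorem exists_levels (G : SimpleGraph V) (R : Finset V) (p : V → ℕ) (c δ : ℕ)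
    (hp : ∀ w ∈ R, p w ≤ c + δ) (col : V → ℕ) (hcol : ∀ u v, G.Adj u v → col u ≠ col v) (n : ℕ) :
    ∃ ℓ : V → ℕ, (∀ v, ℓ v ≤ n) ∧
      (∀ u ∈ R, ∀ v ∈ R, G.Adj u v → ℓ u = ℓ v → ℓ u = n) ∧
      (∀ w ∈ R, p w + ℓ w ≤ c + δ + #{v ∈ R | G.Adj v w ∧ ℓ v < ℓ w}) ∧
      (∀ w ∈ R, ℓ w < n → c + #{v ∈ R | G.Adj v w ∧ ℓ v < ℓ w} ≤ p w + ℓ w) ∧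
      (∀ w ∈ R, ℓ w = n → col w < n → p w + n ≤ c + #{v ∈ R | G.Adj v w ∧ ℓ v < ℓ w}) := by
  induction n with
  | zero => exact ⟨fun _ => 0, by simp, by simp, by simpa using hp, by simp, by simp⟩
  | succ j ih =>
    obtain ⟨ℓ, h0, h1, h2, h3, h4⟩ := ih
    let Z : V → ℕ := fun w => #{v ∈ R | G.Adj v w ∧ ℓ v < ℓ w}
    change ∀ w ∈ R, p w + ℓ w ≤ c + δ + Z w at h2
    change ∀ w ∈ R, ℓ w < j → c + Z w ≤ p w + ℓ w at h3
    change ∀ w ∈ R, ℓ w = j → col w < j → p w + j ≤ c + Z w at h4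
    -- `p w - Z w` is the potential of `w` at level `j` if nothing is given back; `A` consists of
    -- the vertices that still reach the value `c - j`.
    let A : Finset V := {w ∈ R | ℓ w = j ∧ c + Z w ≤ p w + j}
    obtain ⟨B, hB0, hBA, hB, hBmax⟩ := exists_maximal_independent G A {w ∈ A | col w = j}
      (filter_subset _ _) (fun u hu v hv huv => hcol u v huv (by
        rw [mem_filter] at hu hv
        rw [hu.2, hv.2]))
    have hBj : ∀ w ∈ B, w ∈ R ∧ ℓ w = j ∧ c + Z w ≤ p w + j := fun w hw => by
      simpa only [A, mem_filter] using hBA hw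
    let ℓ' : V → ℕ := fun w => if ℓ w = j ∧ w ∉ B then j + 1 else ℓ w
    have hℓlt : ∀ w, ℓ w < j → ℓ' w = ℓ w := fun w hw => if_neg (by omega)
    have hℓB : ∀ w ∈ B, ℓ' w = j := fun w hw => by
      rw [← (hBj w hw).2.1]
      exact if_neg (by tauto)
    have hℓn : ∀ w, ℓ w = j → w ∉ B → ℓ' w = j + 1 := fun w hw hwB => if_pos ⟨hw, hwB⟩
    have hcase : ∀ w, ℓ w < j ∨ w ∈ B ∨ (ℓ w = j ∧ w ∉ B) := fun w => by
      have := h0 w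
      by_cases hw : w ∈ B
      · exact Or.inr (Or.inl hw)
      · rcases this.lt_or_eq with h | h
        · exact Or.inl h
        · exact Or.inr (Or.inr ⟨h, hw⟩)
    have hlow : ∀ v m, m ≤ j → (ℓ' v < m ↔ ℓ v < m) := by
      intro v m hm
      rcases hcase v with h | h | h
      · rw [hℓlt v h]
      · rw [hℓB v h, (hBj v h).2.1]
      · rw [hℓn v h.1 h.2, h.1]
        omega
    have hlow' : ∀ v, ℓ' v < j + 1 ↔ (ℓ v < j ∨ v ∈ B) := by
      intro v
      rcases hcase v with h | h | h
      · rw [hℓlt v h]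
        simp [h]
        omega
      · rw [hℓB v h]
        simp [h]
      · rw [hℓn v h.1 h.2, h.1]
        simp [h.2]
    have hZlt : ∀ w, ℓ' w ≤ j → ℓ' w = ℓ w →
        #{v ∈ R | G.Adj v w ∧ ℓ' v < ℓ' w} = Z w := by
      intro w hw hww
      simp only [Z]
      congr 1
      ext v
      have h5 := hlow v _ hw
      rw [hww] at h5
      simp only [mem_filter, hww, h5]
    have hZn : ∀ w, ℓ w = j → w ∉ B →
        #{v ∈ R | G.Adj v w ∧ ℓ' v < ℓ' w} = Z w + #{v ∈ B | G.Adj v w} := by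
      intro w hw hwB
      rw [hℓn w hw hwB]
      simp only [Z, hw]
      rw [← card_union_of_disjoint]
      · congr 1
        ext v
        simp only [mem_filter, mem_union, hlow']
        have := hBj v
        tauto
      · rw [Finset.disjoint_left]
        intro v hv hv'
        simp only [mem_filter] at hv hv'
        have := hBj v hv'.1
        omega
    refine ⟨ℓ', ?_, ?_, ?_, ?_, ?_⟩
    · intro v
      rcases hcase v with h | h | h
      · rw [hℓlt v h]
        omega
      · rw [hℓB v h]
        omega
      · rw [hℓn v h.1 h.2]
    · intro u hu v hv huv he
      rcases hcase u with h | h | h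
      · exfalso
        have h5 := hℓlt u h
        rcases hcase v with h' | h' | h'
        · rw [hℓlt v h', h5] at he
          have := h1 u hu v hv huv he
          omega
        · rw [hℓB v h'] at he
          omega
        · rw [hℓn v h'.1 h'.2] at he
          omega
      · exfalso
        have h5 := hℓB u h
        rcases hcase v with h' | h' | h'
        · rw [hℓlt v h', h5] at he
          omega
        · exact hB u h v h' huv
        · rw [hℓn v h'.1 h'.2] at he
          omega
      · exact hℓn u h.1 h.2
    · intro w hw
      have h5 := h2 w hw
      rcases hcase w with h | h | h
      · rw [hZlt w (by rw [hℓlt w h]; omega) (hℓlt w h), hℓlt w h]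
        exact h5
      · rw [hZlt w (hℓB w h).le ((hℓB w h).trans (hBj w h).2.1.symm), hℓB w h]
        rw [(hBj w h).2.1] at h5
        exact h5
      · rw [hZn w h.1 h.2, hℓn w h.1 h.2]
        rw [h.1] at h5
        -- By maximality of `B` an eligible vertex left out has a neighbour in `B`, so its potential
        -- falls along with the level; an ineligible one was already below it.
        by_cases hwA : w ∈ A
        · obtain ⟨v, hv, hvw⟩ := hBmax w hwA h.2
          have : 0 < #{v ∈ B | G.Adj v w} := card_pos.2 ⟨v, by simp [hv, hvw]⟩
          omega
        · have : ¬ (c + Z w ≤ p w + j) := fun h6 => hwA (by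
            simp only [A, mem_filter]
            exact ⟨hw, h.1, h6⟩)
          omega
    · intro w hw hwj
      rcases hcase w with h | h | h
      · rw [hZlt w (by rw [hℓlt w h]; omega) (hℓlt w h), hℓlt w h]
        exact h3 w hw h
      · rw [hZlt w (hℓB w h).le ((hℓB w h).trans (hBj w h).2.1.symm), hℓB w h]
        exact (hBj w h).2.2
      · rw [hℓn w h.1 h.2] at hwj
        omega
    · intro w hw hwj hwc
      rcases hcase w with h | h | h
      · rw [hℓlt w h] at hwj
        omega
      · rw [hℓB w h] at hwj
        omega
      · rw [hZn w h.1 h.2]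
        by_cases hwA : w ∈ A
        · obtain ⟨v, hv, hvw⟩ := hBmax w hwA h.2
          have h6 : 0 < #{v ∈ B | G.Adj v w} := card_pos.2 ⟨v, by simp [hv, hvw]⟩
          have h7 : col w ≠ j := fun h7 => h.2 (hB0 (by
            rw [mem_filter]
            exact ⟨hwA, h7⟩))
          have := h4 w hw h.1 (by omega)
          omega
        · have : ¬ (c + Z w ≤ p w + j) := fun h6 => hwA (by
            simp only [A, mem_filter]
            exact ⟨hw, h.1, h6⟩)
          omega

/-- Descending `r` levels reduces the excess of the potentials over the current level from `δ` to
`m`. The levels ignore the edges given back; these are then chosen equitably. -/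
theorem IsStage.exists_shrink {D : G.Orientation} {R : Finset V} {k K c δ m g r : ℕ}
    (h : IsStage D R k K (c + r)) (hcK : c + r ≤ K)
    (hp : ∀ w ∈ R, D.potential R w ≤ c + r + δ)
    (col : V → ℕ) (hcol : ∀ u v, G.Adj u v → col u ≠ col v) (hr : ∀ v, col v < r)
    (hg : 0 < g) (hk : (δ + m) * g + k ≤ c + 1) (hm : r + δ ≤ m * g) :
    ∃ (D' : G.Orientation) (R' : Finset V), IsStage D' R' k K c ∧
      ∀ w ∈ R', D'.potential R' w ≤ c + m := by
  obtain ⟨ℓ, l0, l1, l2, l3, l4⟩ := exists_levels G R (D.potential R) (c + r) δ hp col hcol r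
  let Z : V → ℕ := fun w => #{v ∈ R | G.Adj v w ∧ ℓ v < ℓ w}
  change ∀ w ∈ R, D.potential R w + ℓ w ≤ c + r + δ + Z w at l2
  change ∀ w ∈ R, ℓ w < r → c + r + Z w ≤ D.potential R w + ℓ w at l3
  change ∀ w ∈ R, ℓ w = r → col w < r → D.potential R w + r ≤ c + r + Z w at l4
  let I : Finset V := {v ∈ R | ℓ v < r}
  -- Only in-neighbours of higher level qualify: they are still unfixed when `v` is fixed.
  let M : V → Finset V := fun v => {w ∈ R | D.dir w v ∧ ℓ v < ℓ w}
  have hM : ∀ v ∈ I, (δ + m) * g ≤ #(M v) := by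
    intro v hv
    simp only [I, mem_filter] at hv
    have h1 := D.potential_eq R v
    have h2 := h.out_le v hv.1
    have h3 := l3 v hv.1 hv.2
    have h4 : #{w ∈ R | D.dir w v} ≤ #(M v) + Z v := by
      refine le_trans (card_le_card ?_) (card_union_le _ _)
      intro w
      simp only [M, mem_filter, mem_union]
      intro hw
      have h5 := D.adj_of_dir hw.2
      have h6 := l1 w hw.1 v hv.1 h5
      rcases lt_trichotomy (ℓ v) (ℓ w) with h7 | h7 | h7
      · tauto
      · have := h6 h7.symm
        omega
      · tauto
    omega
  obtain ⟨Γ, hΓ, hrec⟩ := exists_equitable_selection I M (δ + m) g hg hM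
  have hrecZ : ∀ w, #{v ∈ I | w ∈ Γ v} ≤ (Z w + g - 1) / g := by
    intro w
    refine (hrec w).trans (Nat.div_le_div_right ?_)
    have : #{v ∈ I | w ∈ M v} ≤ Z w := by
      apply card_le_card
      intro v
      simp only [I, M, mem_filter]
      exact fun h => ⟨h.1.1, (D.adj_of_dir h.2.2.1).symm, h.2.2.2⟩
    omega
  -- Since `r + δ ≤ m * g`, the first `r + δ` lower neighbours account for at most `m` returned
  -- edges. Each further one accounts for at most one, which the drop it causes already pays for.
  have hrecm : ∀ w, #{v ∈ I | w ∈ Γ v} ≤ m + (Z w - (r + δ)) := by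
    intro w
    refine (hrecZ w).trans (Nat.lt_succ_iff.1 ((Nat.div_lt_iff_lt_mul hg).2 ?_))
    have h1 : Z w ≤ (r + δ) + (Z w - (r + δ)) := by omega
    have h2 : (Z w - (r + δ)) ≤ (Z w - (r + δ)) * g := Nat.le_mul_of_pos_right _ hg
    rw [Nat.succ_mul, add_mul]
    omega
  have hind : ∀ j ≤ r, ∃ Dj : G.Orientation, IsStage Dj {w ∈ R | j ≤ ℓ w} k K (c + r - j) ∧
      (∀ a ∈ R, ∀ b ∈ R, j ≤ ℓ a → j ≤ ℓ b → (Dj.dir a b ↔ D.dir a b)) ∧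
      ∀ w ∈ R, j ≤ ℓ w →
        Dj.potential {w ∈ R | j ≤ ℓ w} w + #{v ∈ R | G.Adj v w ∧ ℓ v < j} ≤
          D.potential R w + #{v ∈ I | w ∈ Γ v ∧ ℓ v < j} ∧
        D.potential R w ≤
          Dj.potential {w ∈ R | j ≤ ℓ w} w + #{v ∈ R | G.Adj v w ∧ ℓ v < j} := by
    intro j
    induction j with
    | zero =>
      intro _
      exact ⟨D, by simpa using h, fun _ _ _ _ _ _ => Iff.rfl, by simp⟩
    | succ j ih =>
      intro hj
      obtain ⟨Dj, s1, s2, s3⟩ := ih (by omega)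
      obtain ⟨e, he⟩ : ∃ e, c + r - j = e + 1 := ⟨c + r - j - 1, by omega⟩
      have he' : c + r - (j + 1) = e := by omega
      rw [he] at s1
      rw [he']
      let B : Finset V := {w ∈ R | ℓ w = j}
      have hBI : ∀ v ∈ B, v ∈ I ∧ v ∈ R ∧ ℓ v = j := by
        intro v hv
        simp only [B, I, mem_filter] at hv ⊢
        exact ⟨⟨hv.1, by omega⟩, hv⟩
      have hRj : ({w ∈ R | j ≤ ℓ w} : Finset V) \ B = {w ∈ R | j + 1 ≤ ℓ w} := by
        ext w
        simp only [B, Finset.mem_sdiff, mem_filter]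
        constructor
        · rintro ⟨⟨h1, h2⟩, h3⟩
          have : ℓ w ≠ j := fun h4 => h3 ⟨h1, h4⟩
          exact ⟨h1, by omega⟩
        · rintro ⟨h1, h2⟩
          exact ⟨⟨h1, by omega⟩, fun h3 => by omega⟩
      have hZj : ∀ v ∈ B, #{u ∈ R | G.Adj u v ∧ ℓ u < j} = Z v := fun v hv => by
        simp only [Z, (hBI v hv).2.2]
      -- The true potential exceeds the level by an amount between `0` and `δ + m = #(Γ v)`, so part
      -- of the preselected `Γ v` is exactly what has to be given back.
      have hΓ' : ∀ v, ∃ Γ' : Finset V, v ∈ B → Γ' ⊆ Γ v ∧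
          e + 1 + #Γ' = Dj.potential {w ∈ R | j ≤ ℓ w} v := by
        intro v
        by_cases hv : v ∈ B
        · obtain ⟨b1, b2, b3⟩ := hBI v hv
          have t1 := s3 v b2 b3.ge
          rw [hZj v hv] at t1
          have t2 := l2 v b2
          have t3 := l3 v b2 (by omega)
          have t4 := hrecm v
          have t5 : #{u ∈ I | v ∈ Γ u ∧ ℓ u < j} ≤ #{u ∈ I | v ∈ Γ u} :=
            card_le_card fun u => by
              simp only [mem_filter]
              tauto
          have t6 := (hΓ v b1).2
          have t7 := hp v b2
          obtain ⟨Γ', g1, g2⟩ := exists_subset_card_eq (s := Γ v)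
            (n := Dj.potential {w ∈ R | j ≤ ℓ w} v - (e + 1)) (by omega)
          exact ⟨Γ', fun _ => ⟨g1, by omega⟩⟩
        · exact ⟨∅, fun h => absurd h hv⟩
      choose Γ' hΓ' using hΓ'
      obtain ⟨D', d1, d2, d3⟩ := s1.pull (by omega) (B := B) (by
          intro v hv
          obtain ⟨-, b2, b3⟩ := hBI v hv
          simp only [mem_filter]
          exact ⟨b2, b3.ge⟩) (fun u hu v hv huv => by
            obtain ⟨-, b2, b3⟩ := hBI v hv
            obtain ⟨-, a2, a3⟩ := hBI u hu
            have := l1 u a2 v b2 huv (by omega)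
            omega) Γ' (fun v hv w hw => by
              obtain ⟨b1, b2, b3⟩ := hBI v hv
              have g1 := (hΓ v b1).1 ((hΓ' v hv).1 hw)
              simp only [M, mem_filter] at g1 ⊢
              have g2 : j ≤ ℓ w := by omega
              exact ⟨⟨g1.1, g2⟩, (s2 w g1.1 v b2 g2 b3.ge).2 g1.2.1⟩)
          (fun v hv => (hΓ' v hv).2)
      rw [hRj] at d1 d2 d3
      refine ⟨D', d1, fun a ha b hb haj hbj => ?_, fun w hw hwj => ?_⟩
      · rw [d3 a (by simp only [mem_filter]; exact ⟨ha, haj⟩) b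
          (by simp only [mem_filter]; exact ⟨hb, hbj⟩)]
        exact s2 a ha b hb (by omega) (by omega)
      · have t1 := d2 w (by simp only [mem_filter]; exact ⟨hw, hwj⟩)
        have t2 := s3 w hw (by omega)
        have t3 : #{v ∈ R | G.Adj v w ∧ ℓ v < j + 1} =
            #{v ∈ R | G.Adj v w ∧ ℓ v < j} + #{v ∈ B | G.Adj v w} := by
          rw [← card_union_of_disjoint]
          · congr 1
            ext v
            simp only [B, mem_filter, mem_union, Nat.lt_succ_iff_lt_or_eq]
            tauto
          · rw [Finset.disjoint_left]
            intro v hv hv'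
            simp only [B, mem_filter] at hv hv'
            omega
        have t4 : #{v ∈ I | w ∈ Γ v ∧ ℓ v < j} + #{v ∈ B | w ∈ Γ' v} ≤
            #{v ∈ I | w ∈ Γ v ∧ ℓ v < j + 1} := by
          rw [← card_union_of_disjoint]
          · apply card_le_card
            intro v hv
            simp only [mem_union, mem_filter] at hv
            refine mem_filter.2 ?_
            rcases hv with hv | hv
            · exact ⟨hv.1, hv.2.1, by omega⟩
            · obtain ⟨b1, b2, b3⟩ := hBI v hv.1
              exact ⟨b1, (hΓ' v hv.1).1 hv.2, by omega⟩
          · rw [Finset.disjoint_left]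
            intro v hv hv'
            rw [mem_filter] at hv hv'
            have := (hBI v hv'.1).2.2
            omega
        omega
  obtain ⟨D', h1, -, h2⟩ := hind r le_rfl
  refine ⟨D', {w ∈ R | r ≤ ℓ w}, by simpa using h1, fun w hw => ?_⟩
  rw [mem_filter] at hw
  have h3 : ℓ w = r := le_antisymm (l0 w) hw.2
  have h4 := (h2 w hw.1 hw.2).1
  have h5 := hrecm w
  have h6 := l4 w hw.1 h3 (hr w)
  have h7 := hp w hw.1
  have h9 : #{v ∈ I | w ∈ Γ v ∧ ℓ v < r} ≤ #{v ∈ I | w ∈ Γ v} :=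
    card_le_card fun v => by
      simp only [mem_filter]
      tauto
  have h8 : Z w = #{v ∈ R | G.Adj v w ∧ ℓ v < r} := by simp only [Z, h3]
  omega

end Window

/-! ### Removing the last unit of excess. -/

section LastExcess

open Finset Classical

variable {V : Type*} [Fintype V] {G : SimpleGraph V}

-- Exchange argument: swapping `Q` into `B` in place of its neighbours keeps independence, so it
-- cannot increase the weight.
omit [Fintype V] in
theorem exists_maxWeight_independent (G : SimpleGraph V) (A : Finset V) (ω : V → ℕ) :
    ∃ B ⊆ A, (∀ u ∈ B, ∀ v ∈ B, ¬ G.Adj u v) ∧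
      ∀ Q ⊆ A, (∀ u ∈ Q, ∀ v ∈ Q, ¬ G.Adj u v) → (∀ u ∈ Q, u ∉ B) →
        ∑ u ∈ Q, ω u ≤ ∑ v ∈ B with ∃ u ∈ Q, G.Adj v u, ω v := by
  obtain ⟨B, hB, hmax⟩ := exists_max_image
    {B ∈ A.powerset | ∀ u ∈ B, ∀ v ∈ B, ¬ G.Adj u v} (fun B => ∑ v ∈ B, ω v) ⟨∅, by simp⟩
  simp only [mem_filter, mem_powerset] at hB hmax
  refine ⟨B, hB.1, hB.2, fun Q hQA hQ hQB => ?_⟩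
  have h1 := hmax ({v ∈ B | ¬ ∃ u ∈ Q, G.Adj v u} ∪ Q)
    ⟨union_subset ((filter_subset _ _).trans hB.1) hQA, ?_⟩
  · rw [sum_union] at h1
    · have h2 := sum_filter_add_sum_filter_not B (fun v => ∃ u ∈ Q, G.Adj v u) ω
      omega
    · rw [Finset.disjoint_left]
      exact fun v hv hvQ => hQB v hvQ (mem_filter.1 hv).1
  · intro u hu v hv huv
    simp only [mem_union, mem_filter, not_exists, not_and] at hu hv
    rcases hu with hu | hu <;> rcases hv with hv | hv
    · exact hB.2 u hu.1 v hv.1 huv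
    · exact hu.2 v hv huv
    · exact hv.2 u hu huv.symm
    · exact hQ u hu v hv huv

/-- One level of the removal of an excess of `1`: the independent set that is fixed has maximum
weight, where the vertices of colour `j` with positive excess weigh `3` and the others `2`. -/
theorem IsStage.exists_step {D : G.Orientation} {R : Finset V} {k K c r j : ℕ}
    (h : IsStage D R k K (c + 1)) (hcK : c + 1 ≤ K) (hk : k + r + 5 ≤ c + 1)
    (col : V → ℕ) (hcol : ∀ u v, G.Adj u v → col u ≠ col v) (hr : ∀ v, col v < r)
    (hp : ∀ w ∈ R, D.potential R w ≤ c + 2)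
    (hpj : ∀ w ∈ R, col w < j → D.potential R w ≤ c + 1) :
    ∃ (D' : G.Orientation) (R' : Finset V), IsStage D' R' k K c ∧
      (∀ w ∈ R', D'.potential R' w ≤ c + 1) ∧
      ∀ w ∈ R', col w < j + 1 → D'.potential R' w ≤ c := by
  let A : Finset V := {w ∈ R | c + 1 ≤ D.potential R w}
  let X : V → Prop := fun w => col w = j ∧ D.potential R w = c + 2
  let ω : V → ℕ := fun w => if X w then 3 else 2
  have hω2 : ∀ w, 2 ≤ ω w := fun w => by
    simp only [ω]
    split_ifs <;> omega
  have hω3 : ∀ w, ω w ≤ 3 := fun w => by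
    simp only [ω]
    split_ifs <;> omega
  have hωX : ∀ w, X w → ω w = 3 := fun w hw => if_pos hw
  have hωX' : ∀ w u, X u → G.Adj w u → ω w = 2 := fun w u hu hwu =>
    if_neg fun hw => hcol w u hwu (hw.1.trans hu.1.symm)
  obtain ⟨B, hBA, hB, hswap⟩ := exists_maxWeight_independent G A ω
  have hBR : B ⊆ R := hBA.trans (filter_subset _ _)
  let nb : V → Finset V := fun w => {v ∈ B | G.Adj v w}
  have hone : ∀ w ∈ A, w ∉ B → ω w ≤ ∑ v ∈ nb w, ω v := by
    intro w hw hwB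
    have := hswap {w} (by simpa using hw) (by simp) (by simpa using hwB)
    simpa [nb] using this
  have hz1 : ∀ w ∈ A, w ∉ B → 1 ≤ #(nb w) := by
    intro w hw hwB
    have h1 := hone w hw hwB
    rw [Nat.one_le_iff_ne_zero, Ne, card_eq_zero]
    intro h2
    rw [h2, sum_empty] at h1
    have := hω2 w
    omega
  have hsumX : ∀ u, X u → ∑ v ∈ nb u, ω v = 2 * #(nb u) := by
    intro u hu
    rw [mul_comm, ← smul_eq_mul, ← sum_const]
    exact sum_congr rfl fun v hv => hωX' v u hu (mem_filter.1 hv).2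
  have hz2 : ∀ u ∈ A, u ∉ B → X u → 2 ≤ #(nb u) := by
    intro u hu huB hX
    have h1 := hone u hu huB
    rw [hsumX u hX, hωX u hX] at h1
    omega
  -- `P v` and `S v` collect the vertices that cannot afford a returned edge from `v`: those with
  -- `v` as only neighbour in `B`, and those that must lose two units and have just two such
  -- neighbours.
  let P : V → Finset V := fun v => {w ∈ A | w ∉ B ∧ nb w = {v}}
  let S : V → Finset V := fun v => {u ∈ A | u ∉ B ∧ X u ∧ #(nb u) = 2 ∧ v ∈ nb u}
  have hP : ∀ v, #(P v) ≤ r := by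
    intro v
    rw [← card_range r]
    refine card_le_card_of_injOn col (fun w _ => by simpa using hr w) ?_
    intro w hw w' hw' hcc
    by_contra hne
    simp only [P, coe_filter, Set.mem_ofPred_eq] at hw hw'
    have hna : ¬ G.Adj w w' := fun h => hcol _ _ h hcc
    have h1 := hswap {w, w'} (by
        intro x hx
        rw [mem_insert, mem_singleton] at hx
        rcases hx with rfl | rfl
        exacts [hw.1, hw'.1])
      (by
        intro x hx y hy
        rw [mem_insert, mem_singleton] at hx hy
        rcases hx with rfl | rfl <;> rcases hy with rfl | rfl
        exacts [G.loopless.irrefl _, hna, fun h => hna h.symm, G.loopless.irrefl _])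
      (by
        intro x hx
        rw [mem_insert, mem_singleton] at hx
        rcases hx with rfl | rfl
        exacts [hw.2.1, hw'.2.1])
    have h2 : ∑ x ∈ B with ∃ u ∈ ({w, w'} : Finset V), G.Adj x u, ω x ≤ ∑ x ∈ {v}, ω x := by
      refine sum_le_sum_of_subset fun x hx => ?_
      rw [mem_filter] at hx
      obtain ⟨hxB, u, hu, hxu⟩ := hx
      rw [mem_insert, mem_singleton] at hu
      rcases hu with rfl | rfl
      · rw [← hw.2.2]
        exact mem_filter.2 ⟨hxB, hxu⟩
      · rw [← hw'.2.2]
        exact mem_filter.2 ⟨hxB, hxu⟩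
    rw [sum_pair hne] at h1
    rw [sum_singleton] at h2
    have := hω2 w
    have := hω2 w'
    have := hω3 v
    omega
  have hS : ∀ v, #(S v) ≤ 2 := by
    intro v
    -- Three vertices of `S v` weigh `9`, but together have at most `1 + 3` neighbours in `B`, each
    -- of weight `2`.
    by_contra! hcon
    obtain ⟨Q, hQS, hQ⟩ := exists_subset_card_eq (s := S v) (n := 3) hcon
    have hQS' : ∀ u ∈ Q, u ∈ A ∧ u ∉ B ∧ X u ∧ #(nb u) = 2 ∧ v ∈ nb u := fun u hu => by
      simpa only [S, mem_filter] using hQS hu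
    have h1 := hswap Q (fun u hu => (hQS' u hu).1)
      (fun u hu u' hu' h => hcol u u' h
        ((hQS' u hu).2.2.1.1.trans (hQS' u' hu').2.2.1.1.symm))
      (fun u hu => (hQS' u hu).2.1)
    have h2 : ∑ u ∈ Q, ω u = 9 := by
      rw [sum_congr rfl fun u hu => hωX u (hQS' u hu).2.2.1, sum_const, hQ, smul_eq_mul]
    have h3 : ({x ∈ B | ∃ u ∈ Q, G.Adj x u} : Finset V) ⊆
        insert v (Q.biUnion fun u => (nb u).erase v) := by
      intro x hx
      obtain ⟨hxB, u, hu, hxu⟩ := mem_filter.1 hx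
      rw [mem_insert, mem_biUnion]
      by_cases hxv : x = v
      · exact Or.inl hxv
      · exact Or.inr ⟨u, hu, mem_erase.2 ⟨hxv, mem_filter.2 ⟨hxB, hxu⟩⟩⟩
    have h4 : #{x ∈ B | ∃ u ∈ Q, G.Adj x u} ≤ 4 := by
      refine (card_le_card h3).trans ((card_insert_le _ _).trans ?_)
      have h5 : #(Q.biUnion fun u => (nb u).erase v) ≤ #Q * 1 :=
        card_biUnion_le_card_mul _ _ _ fun u hu => by
          rw [card_erase_of_mem (hQS' u hu).2.2.2.2, (hQS' u hu).2.2.2.1]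
      omega
    have h5 : ∑ x ∈ B with ∃ u ∈ Q, G.Adj x u, ω x = 2 * #{x ∈ B | ∃ u ∈ Q, G.Adj x u} := by
      rw [mul_comm, ← smul_eq_mul, ← sum_const]
      refine sum_congr rfl fun x hx => ?_
      obtain ⟨-, u, hu, hxu⟩ := mem_filter.1 hx
      exact hωX' x u (hQS' u hu).2.2.1 hxu
    omega
  let M : V → Finset V := fun v => {w ∈ R | D.dir w v} \ (P v ∪ S v)
  have hpB : ∀ v ∈ B, v ∈ R ∧ c + 1 ≤ D.potential R v := fun v hv => mem_filter.1 (hBA hv)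
  -- The `r + 5` incoming edges guaranteed by `hk` leave three after discarding `r` for `P v` and
  -- `2` for `S v`.
  have hM : ∀ v ∈ B, 1 * 3 ≤ #(M v) := by
    intro v hv
    have h1 := D.potential_eq R v
    have h2 := h.out_le v (hBR hv)
    have h3 := le_card_sdiff (P v ∪ S v) {w ∈ R | D.dir w v}
    have h4 := card_union_le (P v) (S v)
    have h5 := hP v
    have h6 := hS v
    have h7 := (hpB v hv).2
    change _ ≤ #(M v) at h3
    omega
  obtain ⟨Γ, hΓ, hrec⟩ := exists_equitable_selection B M 1 3 (by omega) hM
  have hΓ' : ∀ v, ∃ Γ' : Finset V, v ∈ B → Γ' ⊆ Γ v ∧ c + 1 + #Γ' = D.potential R v := by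
    intro v
    by_cases hv : v ∈ B
    · have h1 := (hΓ v hv).2
      have h2 := hpB v hv
      have h3 := hp v h2.1
      obtain ⟨Γ', g1, g2⟩ := exists_subset_card_eq (s := Γ v)
        (n := D.potential R v - (c + 1)) (by omega)
      exact ⟨Γ', fun _ => ⟨g1, by omega⟩⟩
    · exact ⟨∅, fun h => absurd h hv⟩
  choose Γ' hΓ' using hΓ'
  have hM' : ∀ v w, w ∈ M v → w ∈ R ∧ D.dir w v ∧ w ∉ P v ∧ w ∉ S v := by
    intro v w hw
    simp only [M, Finset.mem_sdiff, mem_filter, mem_union, not_or] at hw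
    exact ⟨hw.1.1, hw.1.2, hw.2⟩
  have hΓM : ∀ v ∈ B, ∀ w ∈ Γ' v, w ∈ M v := fun v hv w hw => (hΓ v hv).1 ((hΓ' v hv).1 hw)
  obtain ⟨D', d1, d2, -⟩ := h.pull hcK hBR hB Γ' (fun v hv w hw =>
    ⟨(hM' v w (hΓM v hv w hw)).1, (hM' v w (hΓM v hv w hw)).2.1⟩) (fun v hv => (hΓ' v hv).2)
  -- With `z` neighbours in `B`, at most `⌈z / 3⌉` edges come back: a net loss of at least `1` for
  -- `z ≥ 2` and at least `2` for `z ≥ 3`. The cases `z = 1`, and `z = 2` under `X`, receive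
  -- nothing.
  have hdrop : ∀ w ∈ R \ B, D'.potential (R \ B) w ≤ D.potential R w ∧
      (w ∈ A → D'.potential (R \ B) w + 1 ≤ D.potential R w ∧
        (X w → D'.potential (R \ B) w + 2 ≤ D.potential R w)) := by
    intro w hw
    have t1 : _ + #(nb w) = _ := d2 w hw
    have t2 : #{v ∈ B | w ∈ Γ' v} ≤ #{v ∈ B | w ∈ Γ v} := card_le_card fun v hv => by
      rw [mem_filter] at hv ⊢
      exact ⟨hv.1, (hΓ' v hv.1).1 hv.2⟩
    have t3 := hrec w
    have t4 : ({v ∈ B | w ∈ M v} : Finset V) ⊆ nb w := fun v hv => by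
      rw [mem_filter] at hv
      exact mem_filter.2 ⟨hv.1, (D.adj_of_dir (hM' v w hv.2).2.1).symm⟩
    have t5 := card_le_card t4
    have hwB := (Finset.mem_sdiff.1 hw).2
    refine ⟨by omega, fun hwA => ?_⟩
    have t6 := hz1 w hwA hwB
    by_cases hX : X w
    · have t7 := hz2 w hwA hwB hX
      rcases t7.eq_or_lt with t8 | t8
      · have t9 : #{v ∈ B | w ∈ M v} = 0 := by
          rw [card_eq_zero, filter_eq_empty_iff]
          intro v hv hwM
          exact (hM' v w hwM).2.2.2 (mem_filter.2
            ⟨hwA, hwB, hX, t8.symm, t4 (mem_filter.2 ⟨hv, hwM⟩)⟩)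
        exact ⟨by omega, fun _ => by omega⟩
      · exact ⟨by omega, fun _ => by omega⟩
    · refine ⟨?_, fun h => absurd h hX⟩
      rcases t6.eq_or_lt with t8 | t8
      · have t9 : #{v ∈ B | w ∈ M v} = 0 := by
          rw [card_eq_zero, filter_eq_empty_iff]
          intro v hv hwM
          obtain ⟨x, hx⟩ := card_eq_one.1 t8.symm
          have t10 := t4 (mem_filter.2 ⟨hv, hwM⟩)
          rw [hx, mem_singleton] at t10
          subst t10
          exact (hM' v w hwM).2.2.1 (mem_filter.2 ⟨hwA, hwB, hx⟩)
        omega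
      · omega
  have hA : ∀ w ∈ R \ B, w ∉ A → D.potential R w ≤ c := by
    intro w hw hwA
    by_contra! hcon
    exact hwA (mem_filter.2 ⟨(Finset.mem_sdiff.1 hw).1, hcon⟩)
  refine ⟨D', R \ B, d1, fun w hw => ?_, fun w hw hwj => ?_⟩
  · have h1 := hdrop w hw
    have h2 := hp w (Finset.mem_sdiff.1 hw).1
    by_cases hwA : w ∈ A
    · have := (h1.2 hwA).1
      omega
    · have := hA w hw hwA
      omega
  · have h1 := hdrop w hw
    have h2 := hp w (Finset.mem_sdiff.1 hw).1
    by_cases hwA : w ∈ A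
    · obtain ⟨h3, h4⟩ := h1.2 hwA
      by_cases hX : X w
      · have := h4 hX
        omega
      · have h5 : D.potential R w ≤ c + 1 := by
          rcases Nat.lt_succ_iff_lt_or_eq.1 hwj with h6 | h6
          · exact hpj w (Finset.mem_sdiff.1 hw).1 h6
          · by_contra! h7
            exact hX ⟨h6, by omega⟩
        omega
    · have := hA w hw hwA
      omega

/-- One step per colour: step `j` clears the excess of colour `j`, while the drop of one unit
elsewhere keeps the earlier colours clear. -/
theorem IsStage.exists_clear {D : G.Orientation} {R : Finset V} {k K c r : ℕ}
    (h : IsStage D R k K (c + r)) (hcK : c + r ≤ K) (hk : k + r + 5 ≤ c + 1)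
    (col : V → ℕ) (hcol : ∀ u v, G.Adj u v → col u ≠ col v) (hr : ∀ v, col v < r)
    (hp : ∀ w ∈ R, D.potential R w ≤ c + r + 1) :
    ∃ (D' : G.Orientation) (R' : Finset V), IsStage D' R' k K c ∧
      ∀ w ∈ R', D'.potential R' w ≤ c := by
  suffices H : ∀ j ≤ r, ∃ (D' : G.Orientation) (R' : Finset V), IsStage D' R' k K (c + r - j) ∧
      (∀ w ∈ R', D'.potential R' w ≤ c + r - j + 1) ∧
      ∀ w ∈ R', col w < j → D'.potential R' w ≤ c + r - j by
    obtain ⟨D', R', h1, -, h3⟩ := H r le_rfl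
    rw [Nat.add_sub_cancel] at h1 h3
    exact ⟨D', R', h1, fun w hw => h3 w hw (hr w)⟩
  intro j
  induction j with
  | zero => exact fun _ => ⟨D, R, h, hp, by simp⟩
  | succ j ih =>
    intro hj
    obtain ⟨D', R', h1, h2, h3⟩ := ih (by omega)
    obtain ⟨e, he⟩ : ∃ e, c + r - j = e + 1 := ⟨c + r - j - 1, by omega⟩
    rw [he] at h1 h2 h3
    rw [show c + r - (j + 1) = e by omega]
    exact h1.exists_step (by omega) (by omega) col hcol hr h2 h3

end LastExcess

/-! ### Choice of parameters and level accounting. -/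

section UpperBound

open Finset Classical

variable {V : Type*} [Fintype V] {G : SimpleGraph V}

/-- The first round starts from excess `r - 1`. For `t = 2` the inequality fails for large `r`;
there `r ≤ 2 ^ 3 + 1 = 9` helps. -/
theorem first_shrink_budget {r t m : ℕ} (hr : 3 ≤ r) (ht : 2 ≤ t) (hrt : t = 2 → r ≤ 9)
    (hm : m * t ≤ r + t - 2) : (t + 1) * (r + (r - 1) + m - 1) ≤ 3 * r * t + r + 1 := by
  obtain ⟨q, rfl⟩ : ∃ q, r = q + 3 := ⟨r - 3, by omega⟩
  rcases ht.eq_or_lt with rfl | ht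
  · have := hrt rfl
    omega
  · obtain ⟨u, rfl⟩ : ∃ u, t = u + 3 := ⟨t - 3, by omega⟩
    have h1 : q + 3 + (q + 3 - 1) + m - 1 = 2 * q + 4 + m := by omega
    rw [h1]
    have h2 : m * (u + 3) ≤ q + u + 4 := by omega
    refine Nat.le_of_mul_le_mul_left (c := u + 3) ?_ (by omega)
    nlinarith [Nat.zero_le (q * u), Nat.zero_le (q * u * u), Nat.mul_le_mul_right (u + 4) h2]

theorem later_shrink_budget {r t m δ : ℕ} (hr : 3 ≤ r) (ht : 2 ≤ t) (hrt : t = 2 → r ≤ 9)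
    (hδ0 : 1 ≤ δ) (hδ : δ * t ≤ r + t - 2) (hm : m * t ≤ δ + t - 1) :
    (t + 1) * (r + δ + m - 1) ≤ 2 * r * t + r + 1 := by
  rcases ht.eq_or_lt with rfl | ht
  · have := hrt rfl
    omega
  · obtain ⟨q, rfl⟩ : ∃ q, r = q + 3 := ⟨r - 3, by omega⟩
    obtain ⟨u, rfl⟩ : ∃ u, t = u + 3 := ⟨t - 3, by omega⟩
    obtain ⟨d, rfl⟩ : ∃ d, δ = d + 1 := ⟨δ - 1, by omega⟩
    have hmd : m ≤ d + 1 := by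
      by_contra! h
      have : (d + 2) * (u + 3) ≤ m * (u + 3) := Nat.mul_le_mul_right _ h
      nlinarith [Nat.zero_le (d * u), Nat.sub_add_cancel (show 1 ≤ d + 1 + (u + 3) by omega)]
    have h2 : (d + 1) * (u + 3) ≤ q + u + 4 := by omega
    calc (u + 3 + 1) * (q + 3 + (d + 1) + m - 1) ≤ (u + 4) * (q + 4 + 2 * d) :=
          Nat.mul_le_mul_left _ (by omega)
      _ ≤ _ := by
        refine Nat.le_of_mul_le_mul_left (c := u + 3) ?_ (by omega)
        nlinarith [Nat.zero_le (q * u), Nat.zero_le (q * u * u), Nat.mul_le_mul_right (u + 4) h2]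

/-- The choice is `m = ⌈δ / t⌉` and `g = ⌈(r + δ) / m⌉`, so that `(δ + m) g ≤ (t + 1) m g ≤ (t +
1)(r + δ + m - 1)`. -/
theorem shrink_parameters {r t δ N : ℕ} (ht : 2 ≤ t) (hδ : 1 ≤ δ)
    (hN : ∀ m, m * t ≤ δ + t - 1 → (t + 1) * (r + δ + m - 1) ≤ N) :
    ∃ m g, 0 < g ∧ (δ + m) * g ≤ N ∧ r + δ ≤ m * g ∧ 1 ≤ m ∧ δ ≤ m * t ∧
      m * t ≤ δ + t - 1 := by
  obtain ⟨m, hm⟩ : ∃ m, m = (δ + t - 1) / t := ⟨_, rfl⟩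
  have ht0 : 0 < t := by omega
  have hm1 : m * t ≤ δ + t - 1 := hm ▸ Nat.div_mul_le_self _ _
  have hm2 : δ ≤ m * t := by
    have h1 := Nat.div_add_mod (δ + t - 1) t
    have h2 := Nat.mod_lt (δ + t - 1) ht0
    rw [← hm, mul_comm] at h1
    omega
  have hm0 : 1 ≤ m := by
    by_contra! h
    have : m = 0 := by omega
    rw [this] at hm2
    omega
  obtain ⟨g, hg⟩ : ∃ g, g = (r + δ + m - 1) / m := ⟨_, rfl⟩
  have hg1 : g * m ≤ r + δ + m - 1 := hg ▸ Nat.div_mul_le_self _ _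
  have hg2 : r + δ ≤ m * g := by
    have h1 := Nat.div_add_mod (r + δ + m - 1) m
    have h2 := Nat.mod_lt (r + δ + m - 1) hm0
    rw [← hg] at h1
    omega
  refine ⟨m, g, ?_, ?_, hg2, hm0, hm2, hm1⟩
  · by_contra! h
    have : g = 0 := by omega
    rw [this] at hg2
    omega
  · calc (δ + m) * g ≤ (m * t + m) * g := Nat.mul_le_mul_right _ (by omega)
      _ = (t + 1) * (g * m) := by ring
      _ ≤ (t + 1) * (r + δ + m - 1) := Nat.mul_le_mul_left _ hg1
      _ ≤ N := hN m hm1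

theorem IsStage.exists_shrink_iterate {D : G.Orientation} {R : Finset V} {k r t : ℕ}
    (hr : 3 ≤ r) (ht : 2 ≤ t) (hrt : r - 1 ≤ t ^ (t + 1))
    (h : IsStage D R k (k + 3 * r * (t + 1)) (k + (3 * t + 2) * r))
    (hp : ∀ w ∈ R, D.potential R w ≤ k + (3 * t + 2) * r + (r - 1))
    (col : V → ℕ) (hcol : ∀ u v, G.Adj u v → col u ≠ col v) (hcr : ∀ v, col v < r) :
    ∃ (D' : G.Orientation) (R' : Finset V),
      IsStage D' R' k (k + 3 * r * (t + 1)) (k + (2 * t + 1) * r) ∧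
      ∀ w ∈ R', D'.potential R' w ≤ k + (2 * t + 1) * r + 1 := by
  have hr9 : t = 2 → r ≤ 9 := by
    rintro rfl
    norm_num at hrt
    omega
  -- After `s` rounds the excess is at most `t ^ (t + 1 - s)`. The bound by about `r / t` from the
  -- first round on is kept separately, for `later_shrink_budget`.
  suffices H : ∀ s ≤ t + 1, ∃ (D' : G.Orientation) (R' : Finset V) (δ : ℕ),
      IsStage D' R' k (k + 3 * r * (t + 1)) (k + (3 * t + 2 - s) * r) ∧
      (∀ w ∈ R', D'.potential R' w ≤ k + (3 * t + 2 - s) * r + δ) ∧ 1 ≤ δ ∧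
      δ ≤ t ^ (t + 1 - s) ∧ (s = 0 → δ = r - 1) ∧ (1 ≤ s → δ * t ≤ r + t - 2) by
    obtain ⟨D', R', δ, h1, h2, -, h3, -⟩ := H (t + 1) le_rfl
    rw [show 3 * t + 2 - (t + 1) = 2 * t + 1 by omega] at h1 h2
    rw [Nat.sub_self, pow_zero] at h3
    exact ⟨D', R', h1, fun w hw => (h2 w hw).trans (by omega)⟩
  intro s
  induction s with
  | zero =>
    intro _
    exact ⟨D, R, r - 1, h, hp, by omega, hrt, fun _ => rfl, by omega⟩
  | succ s ih =>
    intro hs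
    obtain ⟨D', R', δ, h1, h2, h3, h4, h5, h6⟩ := ih (by omega)
    clear ih
    obtain ⟨a, ha⟩ : ∃ a, 3 * t + 2 - s = a + 1 := ⟨3 * t + 2 - s - 1, by omega⟩
    have ha' : 3 * t + 2 - (s + 1) = a := by omega
    have hat : 2 * t + 1 ≤ a := by omega
    rw [ha, add_mul, one_mul, ← add_assoc] at h1 h2
    rw [ha']
    have hN : ∀ m, m * t ≤ δ + t - 1 → (t + 1) * (r + δ + m - 1) ≤ a * r + 1 := by
      intro m hm
      rcases Nat.eq_zero_or_pos s with h0 | h0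
      · have h7 := h5 h0
        subst h7
        refine (first_shrink_budget hr ht hr9 (by omega)).trans ?_
        have : a = 3 * t + 1 := by omega
        rw [this]
        exact le_of_eq (by ring)
      · refine (later_shrink_budget hr ht hr9 h3 (h6 h0) hm).trans ?_
        have := Nat.mul_le_mul_right r hat
        calc 2 * r * t + r + 1 = (2 * t + 1) * r + 1 := by ring
          _ ≤ _ := by omega
    obtain ⟨m, g, hg, hg1, hg2, hm0, hm1, hm2⟩ := shrink_parameters ht h3 hN
    have haK : k + a * r + r ≤ k + 3 * r * (t + 1) := by
      have : (a + 1) * r ≤ (3 * (t + 1)) * r := Nat.mul_le_mul_right r (by omega)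
      calc k + a * r + r = k + (a + 1) * r := by ring
        _ ≤ k + (3 * (t + 1)) * r := by omega
        _ = _ := by ring
    obtain ⟨D'', R'', g1, g2⟩ := h1.exists_shrink haK h2 col hcol hcr hg
      (by omega) hg2
    refine ⟨D'', R'', m, g1, g2, hm0, ?_, by omega, fun _ => ?_⟩
    · have h7 : m * t < (t ^ (t + 1 - (s + 1)) + 1) * t := by
        rw [add_mul, one_mul, ← pow_succ]
        rw [show t + 1 - (s + 1) + 1 = t + 1 - s by omega]
        omega
      exact Nat.lt_succ_iff.1 (Nat.lt_of_mul_lt_mul_right h7)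
    · rcases Nat.eq_zero_or_pos s with h0 | h0
      · have := h5 h0
        omega
      · have h8 := h6 h0
        have h10 : δ + t ≤ δ * t + 1 := by
          obtain ⟨d, rfl⟩ : ∃ d, δ = d + 1 := ⟨δ - 1, by omega⟩
          have : d ≤ d * t := Nat.le_mul_of_pos_right _ (by omega)
          rw [add_mul]
          omega
        omega

theorem exists_proper_of_outdegree_le {D : G.Orientation} {k r t : ℕ} (hr : 1 ≤ r)
    (hrt : r - 1 ≤ t ^ (t + 1)) (hD : ∀ v, D.outdegree v ≤ k) (hG : G.Colorable r) :
    ∃ D' : G.Orientation, D'.IsProper ∧ ∀ v, D'.outdegree v ≤ k + 3 * r * (t + 1) := by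
  obtain ⟨C⟩ := hG
  let col : V → ℕ := fun v => C v
  have hcol : ∀ u v, G.Adj u v → col u ≠ col v := fun u v huv h => C.valid huv (Fin.ext h)
  have hcr : ∀ v, col v < r := fun v => (C v).2
  have hK : k + r ≤ k + 3 * r * (t + 1) := by
    have : r * 1 ≤ r * (t + 1) := Nat.mul_le_mul_left _ (by omega)
    rw [mul_assoc]
    omega
  obtain ⟨D₁, R₁, h1, h2⟩ := IsStage.exists_of_coloring hD col hcol hcr hK
  have hc : k + 3 * r * (t + 1) - r = k + (3 * t + 2) * r := by
    have : k + 3 * r * (t + 1) = k + (3 * t + 2) * r + r := by ring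
    omega
  rw [hc] at h1
  have h2' : ∀ w ∈ R₁, D₁.potential R₁ w ≤ k + (3 * t + 2) * r + (r - 1) :=
    fun w hw => (h2 w hw).trans (by omega)
  -- The initial excess `r - 1` needs no reduction for `r = 1` and only the clearing round for `r =
  -- 2`.
  rcases (show r = 1 ∨ r = 2 ∨ 3 ≤ r by omega) with rfl | rfl | hr3
  · exact h1.exists_proper (by omega) h2'
  · have ht : 1 ≤ t := by
      by_contra! h
      have : t = 0 := by omega
      subst this
      norm_num at hrt
    have e : k + (3 * t + 2) * 2 = k + (3 * t + 1) * 2 + 2 := by ring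
    rw [e] at h1 h2'
    obtain ⟨D₂, R₂, h3, h4⟩ := h1.exists_clear (by omega) (by omega) col hcol hcr h2'
    exact h3.exists_proper (by omega) h4
  · have ht : 2 ≤ t := by
      by_contra! h
      have : t = 0 ∨ t = 1 := by omega
      rcases this with rfl | rfl <;> norm_num at hrt <;> omega
    obtain ⟨D₂, R₂, h3, h4⟩ := h1.exists_shrink_iterate hr3 ht hrt h2' col hcol hcr
    have e : k + (2 * t + 1) * r = k + 2 * t * r + r := by ring
    rw [e] at h3 h4
    have h5 : 4 * r ≤ 2 * t * r := Nat.mul_le_mul_right _ (by omega)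
    have h6 : k + 3 * r * (t + 1) = k + 2 * t * r + r + (t + 2) * r := by ring
    obtain ⟨D₃, R₃, h7, h8⟩ := h3.exists_clear (by omega) (by omega) col hcol hcr h4
    exact h7.exists_proper (by omega) h8

end UpperBound

/-! ### Orientations from the maximum average degree. -/

section MaximumAverageDegree

open Finset Classical

variable {V : Type*} {G : SimpleGraph V}

theorem two_mul_ncard_edgeSet_le [Finite V] (H : G.Subgraph) :
    2 * (H.edgeSet.ncard : ℝ) ≤ G.mad * H.verts.ncard := by
  rcases H.verts.eq_empty_or_nonempty with h | h
  · have : H.edgeSet = ∅ := by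
      rw [Set.eq_empty_iff_forall_notMem]
      intro e he
      induction e using Sym2.ind with
      | _ a b =>
        have := H.edge_vert (Subgraph.mem_edgeSet.1 he)
        rw [h] at this
        exact this
    simp [h, this]
  · have hpos : (0 : ℝ) < H.verts.ncard := by
      exact_mod_cast (Set.ncard_pos (Set.toFinite _)).2 h
    rw [← div_le_iff₀ hpos]
    refine le_csSup ?_ ⟨H, h, rfl⟩
    refine ((Set.finite_range fun H : G.Subgraph =>
      2 * (H.edgeSet.ncard : ℝ) / (H.verts.ncard : ℝ)).subset ?_).bddAbove
    rintro _ ⟨H', -, rfl⟩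
    exact ⟨H', rfl⟩

theorem mad_nonneg (G : SimpleGraph V) : 0 ≤ G.mad := by
  apply Real.sSup_nonneg
  rintro _ ⟨H, -, rfl⟩
  positivity

/-- Hakimi's theorem. -/
theorem exists_outdegree_le [Fintype V] {k : ℕ} (h : G.mad ≤ 2 * k) :
    ∃ D : G.Orientation, ∀ v, D.outdegree v ≤ k := by
  -- Each edge is matched to one of `k` copies of an endpoint, which becomes its tail. Hall's
  -- condition for `S` is the density bound for the subgraph with edge set `S`.
  let t : G.edgeSet → Finset (V × Fin k) := fun e => ({v | v ∈ e.1} : Finset V) ×ˢ univ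
  have hall : ∀ S : Finset G.edgeSet, #S ≤ #(S.biUnion t) := by
    intro S
    let W : Finset V := {v | ∃ e ∈ S, v ∈ e.1}
    have h1 : S.biUnion t = W ×ˢ univ := by
      ext ⟨v, i⟩
      simp [t, W]
    let H : G.Subgraph :=
      { verts := W
        Adj := fun a b => ∃ h : s(a, b) ∈ G.edgeSet, (⟨s(a, b), h⟩ : G.edgeSet) ∈ S
        adj_sub := fun ⟨h, _⟩ => h
        edge_vert := by
          rintro a b ⟨h, hS⟩
          simp only [W, coe_filter, mem_univ, true_and, Set.mem_ofPred_eq]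
          exact ⟨_, hS, Sym2.mem_mk_left a b⟩
        symm := by
          constructor
          rintro a b ⟨h, hS⟩
          have h' : s(b, a) = s(a, b) := Sym2.eq_swap
          simp only [h']
          exact ⟨h, hS⟩ }
    have hE : H.edgeSet = ((S.map (Function.Embedding.subtype _) : Finset (Sym2 V)) :
        Set (Sym2 V)) := by
      ext e
      induction e using Sym2.ind with
      | _ a b =>
        rw [Subgraph.mem_edgeSet]
        simp [H]
    have h2 := two_mul_ncard_edgeSet_le H
    rw [hE, Set.ncard_coe_finset, card_map] at h2
    have h3 : H.verts.ncard = #W := Set.ncard_coe_finset W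
    rw [h3] at h2
    have h4 : (#S : ℝ) ≤ k * #W := by
      have := mul_le_mul_of_nonneg_right h (Nat.cast_nonneg (α := ℝ) #W)
      linarith
    rw [h1, card_product, card_univ, Fintype.card_fin, mul_comm]
    exact_mod_cast h4
  obtain ⟨φ, hφ, hφt⟩ := (all_card_le_biUnion_card_iff_exists_injective t).1 hall
  have hφm : ∀ e, (φ e).1 ∈ e.1 := fun e => by
    have := hφt e
    simpa [t] using this
  have hswap : ∀ u v (h : G.Adj u v), φ ⟨s(v, u), h.symm⟩ = φ ⟨s(u, v), h⟩ := fun u v h => by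
    congr 2
    exact Sym2.eq_swap
  obtain ⟨D, hD⟩ : ∃ D : G.Orientation, ∀ u v, D.dir u v ↔
      ∃ h : G.Adj u v, (φ ⟨s(u, v), h⟩).1 = u := ⟨
    { dir := fun u v => ∃ h : G.Adj u v, (φ ⟨s(u, v), h⟩).1 = u
      adj_iff := by
        intro u v
        constructor
        · intro h
          rcases Sym2.mem_iff.1 (hφm ⟨s(u, v), h⟩) with h1 | h1
          · exact Or.inl ⟨h, h1⟩
          · exact Or.inr ⟨h.symm, by rw [hswap u v h]; exact h1⟩
        · rintro (⟨h, -⟩ | ⟨h, -⟩)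
          exacts [h, h.symm]
      asymm := by
        rintro u v ⟨h, h1⟩ ⟨h', h2⟩
        rw [hswap u v h] at h2
        exact h.ne (h1.symm.trans h2) }, fun _ _ => Iff.rfl⟩
  refine ⟨D, fun v => ?_⟩
  have hinj : ∀ w, ∃ i : Fin k ⊕ Unit, ∀ h : G.Adj v w,
      (φ ⟨s(v, w), h⟩).1 = v → i = Sum.inl (φ ⟨s(v, w), h⟩).2 := by
    intro w
    by_cases h : G.Adj v w
    · exact ⟨Sum.inl (φ ⟨s(v, w), h⟩).2, fun _ _ => rfl⟩
    · exact ⟨Sum.inr (), fun h' => absurd h' h⟩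
  choose f hf using hinj
  rw [D.outdegree_eq_card]
  calc #{w | D.dir v w} ≤ #(univ.image (Sum.inl : Fin k → Fin k ⊕ Unit)) := by
        refine card_le_card_of_injOn f ?_ ?_
        · intro w hw
          simp only [coe_filter, mem_univ, true_and, Set.mem_ofPred_eq, hD] at hw
          obtain ⟨h1, h2⟩ := hw
          rw [hf w h1 h2]
          simp
        · intro w hw w' hw' hww
          simp only [coe_filter, mem_univ, true_and, Set.mem_ofPred_eq, hD] at hw hw'
          obtain ⟨h1, h2⟩ := hw
          obtain ⟨h1', h2'⟩ := hw'
          rw [hf w h1 h2, hf w' h1' h2'] at hww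
          have h3 : φ ⟨s(v, w), h1⟩ = φ ⟨s(v, w'), h1'⟩ :=
            Prod.ext (h2.trans h2'.symm) (Sum.inl.inj hww)
          have h4 := congrArg Subtype.val (hφ h3)
          exact Sym2.congr_right.1 h4
    _ ≤ k := by
        refine card_image_le.trans ?_
        simp

theorem properChromaticNumber_le_of_mad_le [Finite V] {r k t : ℕ} (hr : 1 ≤ r)
    (hG : G.Colorable r) (hk : G.mad ≤ 2 * k) (ht : r - 1 ≤ t ^ (t + 1)) :
    G.properChromaticNumber ≤ ((k + 3 * r * (t + 1) : ℕ) : ℕ∞) := by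
  have := Fintype.ofFinite V
  obtain ⟨D, hD⟩ := exists_outdegree_le hk
  obtain ⟨D', h1, h2⟩ := exists_proper_of_outdegree_le hr ht hD hG
  exact iInf₂_le_of_le D' h1 (iSup_le fun v => Nat.cast_le.2 (h2 v))

end MaximumAverageDegree

/-! ### Growth of the number of rounds. -/

section Asymptotics

/-- Used with `x = log r` and `τ = levelNumber r`, where the conclusion contradicts
`levelNumber_mul_log_lt`. -/
theorem eventually_le_mul_log {η : ℝ} (hη : 0 < η) :
    ∀ᶠ x : ℝ in atTop, ∀ τ : ℝ, (1 + η) * x / Real.log x < τ + 1 → x ≤ τ * Real.log (τ - 1) := by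
  -- For large `x` one gets `τ ≥ (1 + η / 2) x / log x` and `τ - 1 ≥ x ^ α`; this `α` makes the
  -- product of the two bounds exactly `x`.
  obtain ⟨α, hα⟩ : ∃ α, α = 1 / (1 + η / 2) := ⟨_, rfl⟩
  have hα0 : 0 < α := by rw [hα]; positivity
  have hα1 : (1 + η / 2) * α = 1 := by rw [hα]; field_simp
  have hα2 : α < 1 := by nlinarith
  have h1 : ∀ᶠ x : ℝ in atTop, ‖Real.log x‖ ≤ (1 / 2) * ‖x ^ (1 - α)‖ :=
    (isLittleO_log_rpow_atTop (by linarith)).bound (by norm_num)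
  have h2 : ∀ᶠ x : ℝ in atTop, ‖Real.log x‖ ≤ (η / 2) * ‖x‖ :=
    Real.isLittleO_log_id_atTop.bound (by positivity)
  have h3 : ∀ᶠ x : ℝ in atTop, 2 ≤ x ^ α :=
    (tendsto_rpow_atTop hα0).eventually_ge_atTop 2
  filter_upwards [h1, h2, h3, eventually_gt_atTop 1] with x h1 h2 h3 hx τ hτ
  have hx0 : 0 < x := by linarith
  have hl : 0 < Real.log x := Real.log_pos hx
  rw [Real.norm_of_nonneg hl.le, Real.norm_of_nonneg (Real.rpow_nonneg hx0.le _)] at h1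
  rw [Real.norm_of_nonneg hl.le, Real.norm_of_nonneg hx0.le] at h2
  have h4 : 1 ≤ (η / 2) * (x / Real.log x) := by
    rw [← mul_div_assoc, le_div_iff₀ hl]
    linarith
  have h5 : 2 * x ^ α ≤ x / Real.log x := by
    rw [le_div_iff₀ hl]
    have h6 : x ^ α * x ^ (1 - α) = x := by
      rw [← Real.rpow_add hx0]
      simp
    nlinarith [mul_le_mul_of_nonneg_left h1 (Real.rpow_nonneg hx0.le α)]
  have h7 : (1 + η) * x / Real.log x = (1 + η) * (x / Real.log x) := mul_div_assoc _ _ _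
  rw [h7] at hτ
  have hq : 0 < x / Real.log x := div_pos hx0 hl
  have h8 : (1 + η / 2) * (x / Real.log x) ≤ τ := by nlinarith
  have h9 : x ^ α ≤ τ - 1 := by nlinarith
  have h10 : α * Real.log x ≤ Real.log (τ - 1) := by
    rw [← Real.log_rpow hx0]
    exact Real.log_le_log (Real.rpow_pos_of_pos hx0 _) h9
  calc x = ((1 + η / 2) * (x / Real.log x)) * (α * Real.log x) := by
        have : (1 + η / 2) * (x / Real.log x) * (α * Real.log x) =
          ((1 + η / 2) * α) * (x / Real.log x * Real.log x) := by ring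
        rw [this, hα1, one_mul, div_mul_cancel₀ _ hl.ne']
    _ ≤ τ * Real.log (τ - 1) := by
        apply mul_le_mul h8 h10 (by positivity)
        linarith [mul_pos (show (0 : ℝ) < 1 + η / 2 by positivity) hq]

theorem one_lt_log_of_three_le {r : ℕ} (hr : 3 ≤ r) : 1 < Real.log r := by
  rw [Real.lt_log_iff_exp_lt (by positivity)]
  have : (3 : ℝ) ≤ r := by exact_mod_cast hr
  linarith [Real.exp_one_lt_d9]

/-- The least `t` with `r - 1 ≤ t ^ (t + 1)`. -/
noncomputable def levelNumber (r : ℕ) : ℕ := sInf {s : ℕ | (r : ℤ) - 1 ≤ (s : ℤ) ^ (s + 1)}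

theorem isLeast_levelNumber (r : ℕ) :
    IsLeast {s : ℕ | (r : ℤ) - 1 ≤ (s : ℤ) ^ (s + 1)} (levelNumber r) := by
  refine ⟨Nat.sInf_mem ⟨r, ?_⟩, fun s hs => Nat.sInf_le hs⟩
  have : r ≤ r ^ (r + 1) := Nat.le_self_pow (by omega) r
  have h : (r : ℤ) ≤ (r : ℤ) ^ (r + 1) := by exact_mod_cast this
  change (r : ℤ) - 1 ≤ (r : ℤ) ^ (r + 1)
  omega

/-- Logarithm of the failure of minimality's predecessor: `t - 1` is not admissible, so `(t - 1) ^ t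
< r`. -/
theorem levelNumber_mul_log_lt {r : ℕ} (h : 3 ≤ levelNumber r) :
    (levelNumber r : ℝ) * Real.log ((levelNumber r : ℝ) - 1) < Real.log r := by
  obtain ⟨s, hs⟩ : ∃ s, levelNumber r = s + 1 := ⟨levelNumber r - 1, by omega⟩
  have h1 : ¬ ((r : ℤ) - 1 ≤ (s : ℤ) ^ (s + 1)) := fun h2 => by
    have := (isLeast_levelNumber r).2 h2
    omega
  have h2 : (s : ℝ) ^ (s + 1) < r := by
    have : (s : ℤ) ^ (s + 1) < (r : ℤ) := by omega
    exact_mod_cast this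
  rw [hs]
  have hs0 : (0 : ℝ) < s := by
    have : 0 < s := by omega
    exact_mod_cast this
  have h3 := Real.log_lt_log (by positivity) h2
  rw [Real.log_pow] at h3
  simpa using h3

/-- The relative error of the asymptotic bound `log r / log (log r)` for `levelNumber r + 1`. -/
noncomputable def levelError (r : ℕ) : ℝ :=
  max 0 (((levelNumber r : ℝ) + 1) * Real.log (Real.log r) / Real.log r - 1)

theorem tendsto_levelError : Tendsto levelError atTop (𝓝 0) := by
  rw [Metric.tendsto_nhds]
  intro η hη
  have hlog : Tendsto (fun r : ℕ => Real.log r) atTop atTop :=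
    Real.tendsto_log_atTop.comp tendsto_natCast_atTop_atTop
  have hη2 : 0 < η / 2 := by positivity
  have hbig : ∀ᶠ x : ℝ in atTop, 4 ≤ x / Real.log x := by
    have h2 : ∀ᶠ x : ℝ in atTop, ‖Real.log x‖ ≤ (1 / 4) * ‖x‖ :=
      Real.isLittleO_log_id_atTop.bound (by norm_num)
    filter_upwards [h2, eventually_gt_atTop 1] with x h2 hx
    have hl : 0 < Real.log x := Real.log_pos hx
    rw [Real.norm_of_nonneg hl.le, Real.norm_of_nonneg (by linarith)] at h2
    rw [le_div_iff₀ hl]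
    linarith
  filter_upwards [hlog.eventually (eventually_le_mul_log hη2), hlog.eventually hbig,
    eventually_ge_atTop 3] with r h1 h2 hr
  have hL := one_lt_log_of_three_le hr
  have hl : 0 < Real.log (Real.log r) := Real.log_pos hL
  have hle : ((levelNumber r : ℝ) + 1) * Real.log (Real.log r) / Real.log r - 1 ≤ η / 2 := by
    by_contra! hcon
    have h3 : (1 + η / 2) * Real.log r / Real.log (Real.log r) < (levelNumber r : ℝ) + 1 := by
      rw [div_lt_iff₀ hl]
      have h4 : 1 + η / 2 < ((levelNumber r : ℝ) + 1) * Real.log (Real.log r) / Real.log r := by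
        linarith
      rwa [lt_div_iff₀ (by linarith)] at h4
    have h5 : (4 : ℝ) < (levelNumber r : ℝ) + 1 := by
      refine lt_of_le_of_lt ?_ h3
      rw [mul_div_assoc]
      nlinarith
    have h6 : 3 ≤ levelNumber r := by
      have : (4 : ℝ) < ((levelNumber r + 1 : ℕ) : ℝ) := by push_cast; exact h5
      have : 4 < levelNumber r + 1 := by exact_mod_cast this
      omega
    have := levelNumber_mul_log_lt h6
    have := h1 _ h3
    linarith
  rw [Real.dist_eq, sub_zero, abs_of_nonneg (le_max_left _ _)]
  exact lt_of_le_of_lt (max_le hη2.le hle) (by linarith)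

theorem three_mul_levelNumber_le {r : ℕ} (hr : 3 ≤ r) :
    3 * (r : ℝ) * ((levelNumber r : ℝ) + 1) ≤
      3 * (1 + levelError r) * (r : ℝ) * Real.log r / Real.log (Real.log r) := by
  have hL := one_lt_log_of_three_le hr
  have hl : 0 < Real.log (Real.log r) := Real.log_pos hL
  have h1 : ((levelNumber r : ℝ) + 1) * Real.log (Real.log r) / Real.log r ≤
      1 + levelError r := by
    have := le_max_right 0 (((levelNumber r : ℝ) + 1) * Real.log (Real.log r) / Real.log r - 1)
    unfold levelError
    linarith
  rw [div_le_iff₀ (by linarith)] at h1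
  rw [le_div_iff₀ hl]
  have hr0 : (0 : ℝ) ≤ 3 * r := by positivity
  calc _ = 3 * (r : ℝ) * (((levelNumber r : ℝ) + 1) * Real.log (Real.log r)) := by ring
    _ ≤ 3 * (r : ℝ) * ((1 + levelError r) * Real.log r) := mul_le_mul_of_nonneg_left h1 hr0
    _ = _ := by ring

end Asymptotics

end SimpleGraph

theorem mainTheorem2 :
    (∀ (V : Type*) [Finite V] (G : SimpleGraph V) (r k t : ℕ), 1 ≤ r → G.Colorable r →
      G.mad ≤ 2 * (k : ℝ) → IsLeast {s : ℕ | (r : ℤ) - 1 ≤ (s : ℤ) ^ (s + 1)} t →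
      G.properChromaticNumber ≤ ((k + 3 * r * (t + 1) : ℕ) : ℕ∞)) ∧
    (∃ ε : ℕ → ℝ, Tendsto ε atTop (𝓝 0) ∧
      ∀ r t : ℕ, 3 ≤ r → IsLeast {s : ℕ | (r : ℤ) - 1 ≤ (s : ℤ) ^ (s + 1)} t →
      3 * (r : ℝ) * ((t : ℝ) + 1) ≤
        3 * (1 + ε r) * (r : ℝ) * Real.log r / Real.log (Real.log r)) ∧
    (∃ C : ℝ, ∀ (V : Type*) [Finite V] (G : SimpleGraph V) (r : ℕ), 3 ≤ r →
      G.chromaticNumber = (r : ℕ∞) →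
      ∃ n : ℕ, G.properChromaticNumber = (n : ℕ∞) ∧
        (n : ℝ) ≤ G.mad / 2 + C * ((r : ℝ) * Real.log r / Real.log (Real.log r))) := by
  have hpow : ∀ r t : ℕ, IsLeast {s : ℕ | (r : ℤ) - 1 ≤ (s : ℤ) ^ (s + 1)} t →
      r - 1 ≤ t ^ (t + 1) := by
    intro r t ht
    have h : (r : ℤ) - 1 ≤ ((t ^ (t + 1) : ℕ) : ℤ) := by
      push_cast
      exact ht.1
    omega
  refine ⟨?_, ⟨SimpleGraph.levelError, SimpleGraph.tendsto_levelError, ?_⟩, ?_⟩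
  · intro V _ G r k t hr hG hk ht
    exact G.properChromaticNumber_le_of_mad_le hr hG hk (hpow r t ht)
  · intro r t hr ht
    rw [ht.unique (SimpleGraph.isLeast_levelNumber r)]
    exact SimpleGraph.three_mul_levelNumber_le hr
  · obtain ⟨B, hB⟩ := SimpleGraph.tendsto_levelError.bddAbove_range
    -- The final `+ 1` absorbs rounding `mad / 2` up to an integer, because `r log r / log log r ≥
    -- 1`.
    refine ⟨3 * (1 + B) + 1, fun V _ G r hr hχ => ?_⟩
    have hG : G.Colorable r := SimpleGraph.chromaticNumber_le_iff_colorable.1 hχ.le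
    have hk : G.mad ≤ 2 * ((⌈G.mad / 2⌉₊ : ℕ) : ℝ) := by
      have := Nat.le_ceil (G.mad / 2)
      linarith
    have hle := G.properChromaticNumber_le_of_mad_le (by omega) hG hk
      (hpow r _ (SimpleGraph.isLeast_levelNumber r))
    obtain ⟨n, hn⟩ := ENat.ne_top_iff_exists.1 (ne_top_of_le_ne_top (ENat.natCast_ne_top _) hle)
    refine ⟨n, hn.symm, ?_⟩
    rw [← hn] at hle
    have hle' : (n : ℝ) ≤ (⌈G.mad / 2⌉₊ : ℝ) + 3 * r * (SimpleGraph.levelNumber r + 1) := by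
      exact_mod_cast Nat.cast_le.1 hle
    have hceil : (⌈G.mad / 2⌉₊ : ℝ) ≤ G.mad / 2 + 1 :=
      (Nat.ceil_lt_add_one (div_nonneg G.mad_nonneg (by norm_num))).le
    have hL := SimpleGraph.one_lt_log_of_three_le hr
    have hl : 0 < Real.log (Real.log r) := Real.log_pos hL
    obtain ⟨X, hX⟩ : ∃ X, X = (r : ℝ) * Real.log r / Real.log (Real.log r) := ⟨_, rfl⟩
    have hr3 : (3 : ℝ) ≤ r := by exact_mod_cast hr
    have hX1 : 1 ≤ X := by
      rw [hX, le_div_iff₀ hl]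
      have := Real.log_le_sub_one_of_pos (show 0 < Real.log r by linarith)
      nlinarith
    have h3 : 3 * (r : ℝ) * ((SimpleGraph.levelNumber r : ℝ) + 1) ≤ 3 * (1 + SimpleGraph.levelError r) * X := by
      refine (SimpleGraph.three_mul_levelNumber_le hr).trans (le_of_eq ?_)
      rw [hX]
      ring
    have h4 : 3 * (1 + SimpleGraph.levelError r) * X ≤ 3 * (1 + B) * X := by
      have := hB ⟨r, rfl⟩
      exact mul_le_mul_of_nonneg_right (by linarith) (by linarith)
    rw [← hX]
    nlinarith
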